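/- Let $\mathbb{E}$ be the Engel group, i.e. the connected, simply connected Lie group whose Lie algebra is $\mathfrak{e}=V_1\oplus V_2\oplus V_3$ with $V_1=\mathrm{span}\{X_1,X_2\}$, $V_2=\mathrm{span}\{X_3\}$, $V_3=\mathrm{span}\{X_4\}$, where $X_1,\dots,X_4$ is a basis and the only nonzero brackets among its elements are $[X_1,X_2]=X_3$ and $[X_1,X_3]=X_4$ (and their opposites). It is identified with $\mathbb{R}^4$ through exponential coordinates of the second kind, $(x_1,x_2,x_3,x_4)\leftrightarrow \exp(x_4X_4)\exp(x_3X_3)\exp(x_2X_2)\exp(x_1X_1)$, and elements of $\mathfrak{e}$ are viewed as left invariant vector fields. For a curve $\gamma$ in $\mathbb{E}$ differentiable at $t$, write $\gamma'(t)\in\mathfrak{e}$ for the element $V$ such that the derivative of $\gamma$ at $t$ is $V(\gamma(t))$. An absolutely continuous curve $\gamma:[a,b]\to\mathbb{E}$ is horizontal if $\gamma'(t)=u_1(t)X_1+u_2(t)X_2$ for a.e. $t$; its length is $\int_a^b |u|$, with $|u|=\sqrt{u_1^2+u_2^2}$, and the Carnot–Carathéodory distance $d(x,y)$ is the infimum of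 the lengths of the horizontal curves joining $x$ to $y$. A curve $\Gamma:\mathbb{R}\to\mathbb{E}$ is $C^1_H$ if it is continuously differentiable and $\Gamma'(t)\in V_1$ for all $t$. Then $\mathbb{E}$ has the $C^1_H$ Whitney extension property on $V_1\setminus\mathrm{span}\{X_2\}$: for every compact $K\subset\mathbb{R}$, every continuous $\gamma:K\to\mathbb{E}$ and every continuous $X:K\to V_1\setminus\mathrm{span}\{X_2\}$, if \[ r_{K,\eta}:=\sup_{\substack{\tau,t\in K\\ 0<|\tau-t|<\eta}}\frac{d\big(\gamma(t),\,\gamma(\tau)\exp((t-\tau)X(\tau))\big)}{|\tau-t|}\longrightarrow 0\quad\text{as }\eta\downarrow 0 \] (the supremum over the empty set being $0$), then there is a $C^1_H$ curve $\Gamma:\mathbb{R}\to\mathbb{E}$ such that $\Gamma(t)=\gamma(t)$ and $\Gamma'(t)=X(t)$ for all $t\in K$. -/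

import Mathlib

open Set Filter MeasureTheory Topology
open scoped ENNReal Manifold ContDiff

/-!
### Lie groups in global coordinates

Throughout `G` is a finite-dimensional Lie group whose underlying manifold is a real vector space
(for a Carnot group: exponential coordinates of the first or second kind).  Its Lie algebra is
Mathlib's `GroupLieAlgebra 𝓘(ℝ, G) G`, the tangent space at the identity, and
`mulInvariantVectorField V` is the left invariant vector field with value `V` at the identity.
-/

section LieGroupCurves

variable {G : Type*} [NormedAddCommGroup G] [NormedSpace ℝ G] [Group G]

/-- The left invariant vector field with value `V` at the identity, read in coordinates as a map
`G → G` (each tangent space of the vector space `G` being `G` itself). -/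
noncomputable def leftInvariantField (V : GroupLieAlgebra 𝓘(ℝ, G) G) (p : G) : G :=
  mulInvariantVectorField V p

/-- `φ` is the one-parameter subgroup of `G` whose tangent vector at the identity is `V`. -/
def IsOneParameterSubgroup (V : GroupLieAlgebra 𝓘(ℝ, G) G) (φ : ℝ → G) : Prop :=
  (∀ s t : ℝ, φ (s + t) = φ s * φ t) ∧ HasDerivAt φ (V : G) 0

open Classical in
/-- The exponential map of the Lie group `G`: `exp V = φ 1`, where `φ` is the one-parameter
subgroup with tangent vector `V` at the identity. -/
noncomputable def lieGroupExp (V : GroupLieAlgebra 𝓘(ℝ, G) G) : G :=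
  if h : ∃ φ : ℝ → G, IsOneParameterSubgroup V φ then h.choose 1 else 1

/-- The curve `γ` is differentiable at `t`, and its velocity there, viewed as an element of the Lie
algebra, is `V`: the derivative of `γ` in coordinates is the value at `γ t` of the left invariant
vector field `V`. In short, `γ'(t) = V`. -/
def HasLieDerivAt (γ : ℝ → G) (V : GroupLieAlgebra 𝓘(ℝ, G) G) (t : ℝ) : Prop :=
  HasDerivAt γ (leftInvariantField V (γ t)) t

variable {r : ℕ}

/-- The horizontal layer: the span of its fixed basis `X₁, …, X_r`. -/
noncomputable def horizontalLayer (X : Fin r → GroupLieAlgebra 𝓘(ℝ, G) G) :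
    Submodule ℝ (GroupLieAlgebra 𝓘(ℝ, G) G) :=
  Submodule.span ℝ (Set.range X)

/-- `γ` is, on `[a, b]`, a horizontal curve with controls `u = (u₁, …, u_r)`: it is absolutely
continuous and `γ'(t) = ∑ u_j(t) X_j` for almost every `t ∈ [a, b]`. -/
def IsHorizontalCurve (X : Fin r → GroupLieAlgebra 𝓘(ℝ, G) G) (γ : ℝ → G)
    (u : ℝ → EuclideanSpace ℝ (Fin r)) (a b : ℝ) : Prop :=
  AbsolutelyContinuousOnInterval γ a b ∧
    ∀ᵐ t ∂(volume.restrict (Icc a b)), HasLieDerivAt γ (∑ j, u t j • X j) t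

/-- The Carnot–Carathéodory distance: the infimum of the lengths `∫_a^b |u|` of the horizontal
curves joining `x` to `y`. -/
noncomputable def ccDist (X : Fin r → GroupLieAlgebra 𝓘(ℝ, G) G) (x y : G) : ℝ≥0∞ :=
  sInf {ℓ | ∃ (a b : ℝ) (γ : ℝ → G) (u : ℝ → EuclideanSpace ℝ (Fin r)),
    a ≤ b ∧ γ a = x ∧ γ b = y ∧ IsHorizontalCurve X γ u a b ∧ ℓ = ∫⁻ t in Icc a b, ‖u t‖ₑ}

/-- `Γ : ℝ → G` is `C¹_H`: it is continuously differentiable and horizontal. -/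
def IsC1H (X : Fin r → GroupLieAlgebra 𝓘(ℝ, G) G) (Γ : ℝ → G) : Prop :=
  ContDiff ℝ 1 Γ ∧ ∀ t, ∃ V ∈ horizontalLayer X, HasLieDerivAt Γ V t

/-- The quantity `r_{K,η}`, the supremum over `τ, t ∈ K` with `0 < |τ - t| < η` of
`d(γ(t), γ(τ) exp((t - τ) Y(τ))) / |τ - t|`. -/
noncomputable def whitneyRemainder (X : Fin r → GroupLieAlgebra 𝓘(ℝ, G) G) (K : Set ℝ) (γ : ℝ → G)
    (Y : ℝ → GroupLieAlgebra 𝓘(ℝ, G) G) (η : ℝ) : ℝ≥0∞ :=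
  ⨆ (τ : ℝ) (_ : τ ∈ K) (t : ℝ) (_ : t ∈ K) (_ : 0 < |τ - t|) (_ : |τ - t| < η),
    ccDist X (γ t) (γ τ * lieGroupExp ((t - τ) • Y τ)) / ENNReal.ofReal |τ - t|

/-- The `C¹_H` Whitney extension property on a set `O` of horizontal directions, for a Lie group
`G` whose horizontal layer has the fixed basis `X`. (The maps `γ` and `Y` on `K` are given as
functions on `ℝ`, of which only the values on `K` matter.) -/
def HasC1HWhitneyExtensionProperty [LieGroup 𝓘(ℝ, G) ∞ G]
    (X : Fin r → GroupLieAlgebra 𝓘(ℝ, G) G) (O : Set (GroupLieAlgebra 𝓘(ℝ, G) G)) : Prop :=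
  ∀ (K : Set ℝ) (γ : ℝ → G) (Y : ℝ → GroupLieAlgebra 𝓘(ℝ, G) G),
    IsCompact K → ContinuousOn γ K → ContinuousOn Y K → (∀ t ∈ K, Y t ∈ O) →
    Tendsto (whitneyRemainder X K γ Y) (𝓝[>] 0) (𝓝 0) →
    ∃ Γ : ℝ → G, IsC1H X Γ ∧ (∀ t ∈ K, Γ t = γ t) ∧ ∀ t ∈ K, HasLieDerivAt Γ (Y t) t

end LieGroupCurves

/-!
### The Engel group
-/

/-- The Engel group, identified with `ℝ⁴` through exponential coordinates of the second kind,
`x ↔ exp (x₄ X₄) exp (x₃ X₃) exp (x₂ X₂) exp (x₁ X₁)`. -/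
def Engel : Type := EuclideanSpace ℝ (Fin 4)

namespace Engel

noncomputable instance : NormedAddCommGroup Engel :=
  inferInstanceAs (NormedAddCommGroup (EuclideanSpace ℝ (Fin 4)))

noncomputable instance : NormedSpace ℝ Engel :=
  inferInstanceAs (NormedSpace ℝ (EuclideanSpace ℝ (Fin 4)))

instance : FiniteDimensional ℝ Engel :=
  inferInstanceAs (FiniteDimensional ℝ (EuclideanSpace ℝ (Fin 4)))

/-- The point with coordinates `(x₁, x₂, x₃, x₄)`. -/
def mk (x₁ x₂ x₃ x₄ : ℝ) : Engel := WithLp.toLp 2 ![x₁, x₂, x₃, x₄]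

/-- The coordinates; `coord 0, …, coord 3` are the coordinates `x₁, …, x₄`. -/
noncomputable def coord (i : Fin 4) : Engel →L[ℝ] ℝ := EuclideanSpace.proj (𝕜 := ℝ) i

@[simp] theorem coord_mk_zero (a b c d : ℝ) : coord 0 (mk a b c d) = a := rfl
@[simp] theorem coord_mk_one (a b c d : ℝ) : coord 1 (mk a b c d) = b := rfl
@[simp] theorem coord_mk_two (a b c d : ℝ) : coord 2 (mk a b c d) = c := rfl
@[simp] theorem coord_mk_three (a b c d : ℝ) : coord 3 (mk a b c d) = d := rfl

theorem ext_coord {x y : Engel} (h0 : coord 0 x = coord 0 y) (h1 : coord 1 x = coord 1 y)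
    (h2 : coord 2 x = coord 2 y) (h3 : coord 3 x = coord 3 y) : x = y := by
  apply PiLp.ext
  intro i
  fin_cases i
  exacts [h0, h1, h2, h3]

theorem ext_coord_iff {x y : Engel} : x = y ↔ coord 0 x = coord 0 y ∧ coord 1 x = coord 1 y ∧
    coord 2 x = coord 2 y ∧ coord 3 x = coord 3 y :=
  ⟨by rintro rfl; simp, fun h => ext_coord h.1 h.2.1 h.2.2.1 h.2.2.2⟩

/-- The group law of the Engel group in exponential coordinates of the second kind. -/
noncomputable instance : Mul Engel where
  mul x y := mk (coord 0 x + coord 0 y) (coord 1 x + coord 1 y)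
    (coord 2 x + coord 2 y + coord 0 x * coord 1 y)
    (coord 3 x + coord 3 y + coord 0 x ^ 2 * coord 1 y / 2 + coord 0 x * coord 2 y)

instance : One Engel where
  one := mk 0 0 0 0

noncomputable instance : Inv Engel where
  inv x := mk (-coord 0 x) (-coord 1 x) (coord 0 x * coord 1 x - coord 2 x)
    (coord 0 x * coord 2 x - coord 0 x ^ 2 * coord 1 x / 2 - coord 3 x)

theorem mul_def (x y : Engel) : x * y = mk (coord 0 x + coord 0 y) (coord 1 x + coord 1 y)
    (coord 2 x + coord 2 y + coord 0 x * coord 1 y)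
    (coord 3 x + coord 3 y + coord 0 x ^ 2 * coord 1 y / 2 + coord 0 x * coord 2 y) := rfl

theorem one_def : (1 : Engel) = mk 0 0 0 0 := rfl

theorem inv_def (x : Engel) : x⁻¹ = mk (-coord 0 x) (-coord 1 x) (coord 0 x * coord 1 x - coord 2 x)
    (coord 0 x * coord 2 x - coord 0 x ^ 2 * coord 1 x / 2 - coord 3 x) := rfl

noncomputable instance : Group Engel :=
  Group.ofLeftAxioms
    (fun x y z => by apply ext_coord <;> simp only [mul_def, coord_mk_zero, coord_mk_one,
      coord_mk_two, coord_mk_three] <;> ring)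
    (fun x => by apply ext_coord <;> simp [mul_def, one_def])
    (fun x => by apply ext_coord <;> simp only [mul_def, one_def, inv_def, coord_mk_zero,
      coord_mk_one, coord_mk_two, coord_mk_three] <;> ring)

theorem contDiff_mk {E : Type*} [NormedAddCommGroup E] [NormedSpace ℝ E] {n : WithTop ℕ∞}
    {f g h k : E → ℝ} (hf : ContDiff ℝ n f) (hg : ContDiff ℝ n g) (hh : ContDiff ℝ n h)
    (hk : ContDiff ℝ n k) : ContDiff ℝ n (fun x => mk (f x) (g x) (h x) (k x)) := by
  refine (contDiff_euclidean (𝕜 := ℝ) (ι := Fin 4)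
    (f := fun x => (WithLp.toLp 2 ![f x, g x, h x, k x] : EuclideanSpace ℝ (Fin 4)))).2 ?_
  intro i
  fin_cases i
  exacts [hf, hg, hh, hk]

theorem mk_eq (a b c d : ℝ) :
    mk a b c d = a • mk 1 0 0 0 + b • mk 0 1 0 0 + c • mk 0 0 1 0 + d • mk 0 0 0 1 := by
  apply ext_coord <;> simp

theorem hasDerivAt_mk {f g h k : ℝ → ℝ} {f' g' h' k' t : ℝ} (hf : HasDerivAt f f' t)
    (hg : HasDerivAt g g' t) (hh : HasDerivAt h h' t) (hk : HasDerivAt k k' t) :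
    HasDerivAt (fun t => mk (f t) (g t) (h t) (k t)) (mk f' g' h' k') t := by
  rw [mk_eq f' g' h' k', funext fun t => mk_eq (f t) (g t) (h t) (k t)]
  exact (((hf.smul_const _).add (hg.smul_const _)).add (hh.smul_const _)).add (hk.smul_const _)

/-- The group operations are smooth (indeed polynomial). -/
instance : LieGroup 𝓘(ℝ, Engel) ∞ Engel where
  contMDiff_mul := by
    rw [← modelWithCornersSelf_prod, chartedSpaceSelf_prod, contMDiff_iff_contDiff]
    apply contDiff_mk <;> fun_prop
  contMDiff_inv := by
    rw [contMDiff_iff_contDiff]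
    apply contDiff_mk <;> fun_prop

/-- Left translation by `p` is the affine map `q ↦ p + leftLinear p q`; `leftLinear p` is its
differential. -/
noncomputable def leftLinear (p : Engel) : Engel →L[ℝ] Engel :=
  LinearMap.toContinuousLinearMap
    { toFun := fun v => mk (coord 0 v) (coord 1 v) (coord 2 v + coord 0 p * coord 1 v)
        (coord 3 v + coord 0 p ^ 2 * coord 1 v / 2 + coord 0 p * coord 2 v)
      map_add' := fun v w => by apply ext_coord <;> simp <;> ring
      map_smul' := fun c v => by apply ext_coord <;> simp <;> ring }

theorem leftLinear_apply (p v : Engel) : leftLinear p v =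
    mk (coord 0 v) (coord 1 v) (coord 2 v + coord 0 p * coord 1 v)
      (coord 3 v + coord 0 p ^ 2 * coord 1 v / 2 + coord 0 p * coord 2 v) := rfl

theorem mul_eq_add_leftLinear (p q : Engel) : p * q = p + leftLinear p q := by
  apply ext_coord <;> simp [mul_def, leftLinear_apply] <;> ring

/-- The Lie algebra of the Engel group. -/
abbrev LieAlg : Type := GroupLieAlgebra 𝓘(ℝ, Engel) Engel

/-- The tangent vector `v₁ ∂₁ + v₂ ∂₂ + v₃ ∂₃ + v₄ ∂₄` at the identity. -/
def lieMk (v₁ v₂ v₃ v₄ : ℝ) : LieAlg := mk v₁ v₂ v₃ v₄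

/-- `lieCoord 0, …, lieCoord 3` are the coefficients along `∂₁, …, ∂₄` of a tangent vector at the
identity. -/
noncomputable def lieCoord (i : Fin 4) : LieAlg →L[ℝ] ℝ := coord i

@[simp] theorem lieCoord_mk_zero (a b c d : ℝ) : lieCoord 0 (lieMk a b c d) = a := rfl
@[simp] theorem lieCoord_mk_one (a b c d : ℝ) : lieCoord 1 (lieMk a b c d) = b := rfl
@[simp] theorem lieCoord_mk_two (a b c d : ℝ) : lieCoord 2 (lieMk a b c d) = c := rfl
@[simp] theorem lieCoord_mk_three (a b c d : ℝ) : lieCoord 3 (lieMk a b c d) = d := rfl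

theorem ext_lieCoord {V W : LieAlg} (h0 : lieCoord 0 V = lieCoord 0 W)
    (h1 : lieCoord 1 V = lieCoord 1 W) (h2 : lieCoord 2 V = lieCoord 2 W)
    (h3 : lieCoord 3 V = lieCoord 3 W) : V = W :=
  ext_coord (x := V) (y := W) h0 h1 h2 h3

/-- The left invariant vector fields of the Engel group in coordinates. -/
theorem leftInvariantField_eq (V : LieAlg) (p : Engel) :
    leftInvariantField V p =
      mk (lieCoord 0 V) (lieCoord 1 V) (lieCoord 2 V + coord 0 p * lieCoord 1 V)
        (lieCoord 3 V + coord 0 p ^ 2 * lieCoord 1 V / 2 + coord 0 p * lieCoord 2 V) := by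
  have h : HasFDerivAt (fun q : Engel => p * q) (leftLinear p) 1 := by
    rw [funext (mul_eq_add_leftLinear p)]
    exact (leftLinear p).hasFDerivAt.const_add p
  rw [leftInvariantField, mulInvariantVectorField, mfderiv_eq_fderiv, h.fderiv]
  rfl

/-- The vector field `X₁`, with value `∂₁` at the identity. -/
def X₁ : LieAlg := lieMk 1 0 0 0

/-- The vector field `X₂`, with value `∂₂` at the identity. -/
def X₂ : LieAlg := lieMk 0 1 0 0

/-- The vector field `X₃`, with value `∂₃` at the identity. -/
def X₃ : LieAlg := lieMk 0 0 1 0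

/-- The vector field `X₄`, with value `∂₄` at the identity. -/
def X₄ : LieAlg := lieMk 0 0 0 1

/-- `X₁(x) = ∂₁`. -/
theorem leftInvariantField_X₁ (x : Engel) :
    leftInvariantField X₁ x = mk 1 0 0 0 := by
  rw [leftInvariantField_eq]
  apply ext_coord <;> simp [X₁]

/-- `X₂(x) = ∂₂ + x₁ ∂₃ + (x₁² / 2) ∂₄`. -/
theorem leftInvariantField_X₂ (x : Engel) :
    leftInvariantField X₂ x = mk 0 1 (coord 0 x) (coord 0 x ^ 2 / 2) := by
  rw [leftInvariantField_eq]
  apply ext_coord <;> simp [X₂]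

theorem fderiv_field (b c d e : ℝ) (w : Engel) :
    fderiv ℝ (fun p : Engel => mk b c (d + coord 0 p * c) (e + coord 0 p ^ 2 * c / 2 + coord 0 p * d))
      1 w = mk 0 0 (coord 0 w * c) (coord 0 w * d) := by
  have hd : Differentiable ℝ (fun p : Engel =>
      mk b c (d + coord 0 p * c) (e + coord 0 p ^ 2 * c / 2 + coord 0 p * d)) := by
    refine ContDiff.differentiable (n := 1) ?_ one_ne_zero
    apply contDiff_mk <;> fun_prop
  rw [← (hd 1).lineDeriv_eq_fderiv, lineDeriv]
  refine HasDerivAt.deriv ?_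
  have h1 : HasDerivAt (fun t : ℝ => coord 0 (1 + t • w)) (coord 0 w) 0 := by
    have := ((hasDerivAt_id (0 : ℝ)).mul_const (coord 0 w)).const_add (coord 0 (1 : Engel))
    simpa using this
  have h2 := h1.pow 2
  have h0 : coord 0 (1 : Engel) = 0 := rfl
  refine hasDerivAt_mk (hasDerivAt_const _ _) (hasDerivAt_const _ _)
    ((h1.mul_const c).const_add d) ?_
  have := ((((h2.mul_const c).div_const 2).const_add e).fun_add (h1.mul_const d))
  simpa [h0] using this

/-- The Lie bracket of the Lie algebra of the Engel group. -/
theorem lie_eq (V W : LieAlg) : ⁅V, W⁆ =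
    lieMk 0 0 (lieCoord 0 V * lieCoord 1 W - lieCoord 0 W * lieCoord 1 V)
      (lieCoord 0 V * lieCoord 2 W - lieCoord 0 W * lieCoord 2 V) := by
  have key : ∀ V W : LieAlg, fderiv ℝ (leftInvariantField W) 1 (leftInvariantField V (1 : Engel)) =
      mk 0 0 (lieCoord 0 V * lieCoord 1 W) (lieCoord 0 V * lieCoord 2 W) := by
    intro V W
    rw [funext (leftInvariantField_eq W), fderiv_field, leftInvariantField_eq V, coord_mk_zero]
  have h : @Eq Engel (⁅V, W⁆ : LieAlg)
      (VectorField.lieBracket ℝ (leftInvariantField V) (leftInvariantField W) 1) := by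
    rw [GroupLieAlgebra.bracket_def, ← VectorField.mlieBracketWithin_univ,
      VectorField.mlieBracketWithin_eq_lieBracketWithin]
    exact congrFun VectorField.lieBracketWithin_univ 1
  rw [VectorField.lieBracket_eq] at h
  refine h.trans ?_
  simp only [key]
  apply ext_coord <;> simp [lieMk]

/-- The brackets among `X₁, X₂, X₃, X₄`: the only nonzero ones are `[X₁, X₂] = X₃` and
`[X₁, X₃] = X₄` (and their opposites). -/
theorem lie_table : ⁅X₁, X₂⁆ = X₃ ∧ ⁅X₁, X₃⁆ = X₄ ∧ ⁅X₁, X₄⁆ = 0 ∧ ⁅X₂, X₃⁆ = 0 ∧ ⁅X₂, X₄⁆ = 0 ∧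
    ⁅X₃, X₄⁆ = 0 := by
  simp only [lie_eq]
  refine ⟨?_, ?_, ?_, ?_, ?_, ?_⟩ <;> apply ext_lieCoord <;> simp [X₁, X₂, X₃, X₄]

theorem isOneParameterSubgroup_mk (v₁ v₂ v₃ v₄ : ℝ) :
    IsOneParameterSubgroup (lieMk v₁ v₂ v₃ v₄) (fun t : ℝ => mk (t * v₁) (t * v₂)
      (t * v₃ + t ^ 2 * (v₁ * v₂ / 2))
      (t * v₄ + t ^ 2 * (v₁ * v₃ / 2) + t ^ 3 * (v₁ ^ 2 * v₂ / 6))) := by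
  constructor
  · intro s t
    apply ext_coord <;> simp only [mul_def, coord_mk_zero, coord_mk_one,
      coord_mk_two, coord_mk_three] <;> ring
  · have h1 := hasDerivAt_id (0 : ℝ)
    refine hasDerivAt_mk ?_ ?_ ?_ ?_
    · simpa using h1.mul_const v₁
    · simpa using h1.mul_const v₂
    · simpa using (h1.mul_const v₃).fun_add ((h1.pow 2).mul_const (v₁ * v₂ / 2))
    · simpa using ((h1.mul_const v₄).fun_add ((h1.pow 2).mul_const (v₁ * v₃ / 2))).fun_add
        ((h1.pow 3).mul_const (v₁ ^ 2 * v₂ / 6))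

theorem eq_of_isOneParameterSubgroup {v₁ v₂ v₃ v₄ : ℝ} {φ : ℝ → Engel}
    (h : IsOneParameterSubgroup (lieMk v₁ v₂ v₃ v₄) φ) (t : ℝ) :
    φ t = mk (t * v₁) (t * v₂) (t * v₃ + t ^ 2 * (v₁ * v₂ / 2))
      (t * v₄ + t ^ 2 * (v₁ * v₃ / 2) + t ^ 3 * (v₁ ^ 2 * v₂ / 6)) := by
  have h0 : φ 0 = 1 := by
    have := h.1 0 0
    rw [add_zero] at this
    exact left_eq_mul.mp this
  have hφ : ∀ t, HasDerivAt φ (leftLinear (φ t) (mk v₁ v₂ v₃ v₄)) t := by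
    intro t
    have e : φ = fun s => φ t + leftLinear (φ t) (φ (s - t)) := by
      funext s
      rw [← mul_eq_add_leftLinear, ← h.1, add_sub_cancel]
    have h2 : HasDerivAt (fun s => φ (s - t)) (mk v₁ v₂ v₃ v₄) t := by
      refine HasDerivAt.comp_sub_const t t ?_
      rw [sub_self]
      exact h.2
    have h3 := ((leftLinear (φ t)).hasFDerivAt.comp_hasDerivAt t h2).const_add (φ t)
    have h4 : HasDerivAt (fun s => φ t + leftLinear (φ t) (φ (s - t)))
      (leftLinear (φ t) (mk v₁ v₂ v₃ v₄)) t := h3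
    rwa [← e] at h4
  have hc : ∀ (i : Fin 4) (t : ℝ), HasDerivAt (fun s => coord i (φ s))
      (coord i (leftLinear (φ t) (mk v₁ v₂ v₃ v₄))) t :=
    fun i t => (coord i).hasFDerivAt.comp_hasDerivAt t (hφ t)
  have key : ∀ (f g : ℝ → ℝ) (d : ℝ → ℝ), (∀ t, HasDerivAt f (d t) t) →
      (∀ t, HasDerivAt g (d t) t) → f 0 = g 0 → ∀ t, f t = g t := by
    intro f g d hf hg h0 t
    have := is_const_of_deriv_eq_zero (f := fun t => f t - g t)
      (fun t => ((hf t).fun_sub (hg t)).differentiableAt)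
      (fun t => by simpa using ((hf t).fun_sub (hg t)).deriv) t 0
    linarith
  have c0 : ∀ t, coord 0 (φ t) = t * v₁ := by
    refine key _ _ (fun _ => v₁) (fun t => hc 0 t) (fun t => ?_) (by rw [h0]; simp [one_def])
    simpa using (hasDerivAt_id t).mul_const v₁
  have c1 : ∀ t, coord 1 (φ t) = t * v₂ := by
    refine key _ _ (fun _ => v₂) (fun t => hc 1 t) (fun t => ?_) (by rw [h0]; simp [one_def])
    simpa using (hasDerivAt_id t).mul_const v₂
  have c2 : ∀ t, coord 2 (φ t) = t * v₃ + t ^ 2 * (v₁ * v₂ / 2) := by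
    refine key _ _ (fun t => v₃ + t * v₁ * v₂) (fun t => ?_) (fun t => ?_)
      (by rw [h0]; simp [one_def])
    · have := hc 2 t
      rwa [leftLinear_apply, c0] at this
    · have := ((hasDerivAt_id t).mul_const v₃).add
        (((hasDerivAt_id t).pow 2).mul_const (v₁ * v₂ / 2))
      convert! this using 1
      simp
      ring
  have c3 : ∀ t, coord 3 (φ t) =
      t * v₄ + t ^ 2 * (v₁ * v₃ / 2) + t ^ 3 * (v₁ ^ 2 * v₂ / 6) := by
    refine key _ _ (fun t => v₄ + (t * v₁) ^ 2 * v₂ / 2 + t * v₁ * v₃) (fun t => ?_) (fun t => ?_)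
      (by rw [h0]; simp [one_def])
    · have := hc 3 t
      rwa [leftLinear_apply, c0] at this
    · have := (((hasDerivAt_id t).mul_const v₄).add
        (((hasDerivAt_id t).pow 2).mul_const (v₁ * v₃ / 2))).add
        (((hasDerivAt_id t).pow 3).mul_const (v₁ ^ 2 * v₂ / 6))
      convert! this using 1
      simp
      ring
  exact ext_coord (c0 t) (c1 t) (c2 t) (c3 t)

/-- The exponential map of the Engel group in coordinates. -/
theorem lieGroupExp_eq (V : LieAlg) : lieGroupExp V =
    mk (lieCoord 0 V) (lieCoord 1 V) (lieCoord 2 V + lieCoord 0 V * lieCoord 1 V / 2)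
      (lieCoord 3 V + lieCoord 0 V * lieCoord 2 V / 2
        + lieCoord 0 V ^ 2 * lieCoord 1 V / 6) := by
  have hV : V = lieMk (lieCoord 0 V) (lieCoord 1 V) (lieCoord 2 V) (lieCoord 3 V) := by
    apply ext_lieCoord <;> simp
  have hex : ∃ φ : ℝ → Engel, IsOneParameterSubgroup V φ := by
    rw [hV]
    exact ⟨_, isOneParameterSubgroup_mk _ _ _ _⟩
  rw [lieGroupExp, dif_pos hex]
  have hs := hex.choose_spec
  generalize hex.choose = φ at hs
  rw [hV] at hs
  rw [eq_of_isOneParameterSubgroup hs 1]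
  apply ext_coord <;> simp

/-- The coordinates on the Engel group are exponential coordinates of the second kind. -/
theorem mk_eq_lieGroupExp_mul (x₁ x₂ x₃ x₄ : ℝ) : mk x₁ x₂ x₃ x₄ =
    lieGroupExp (x₄ • X₄) * lieGroupExp (x₃ • X₃) * lieGroupExp (x₂ • X₂)
      * lieGroupExp (x₁ • X₁) := by
  simp only [lieGroupExp_eq]
  apply ext_coord <;> simp [X₁, X₂, X₃, X₄, mul_def]

/-- The Engel group is simply connected (in particular connected). -/
instance : SimplyConnectedSpace Engel := inferInstance

/-- The fixed basis `X₁, X₂` of the horizontal layer of the Engel group. -/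
def horizontalFrame : Fin 2 → LieAlg := ![X₁, X₂]

/-- The horizontal layer `V₁ = span {X₁, X₂}` of the Engel group. -/
noncomputable def V₁ : Submodule ℝ LieAlg := horizontalLayer horizontalFrame

end Engel

/-! Along a horizontal curve dx₃ = x₁ dx₂ and dx₄ = (x₁²/2) dx₂, and a horizontal direction lies
outside span X₂ exactly when its first component is nonzero. So x₁ can play the role of parameter:
put dx₂ = P dx₁ with P a function of x₁. Joining the identity to a point with first coordinate p ≠ 0
is then a linear problem: the slope P must have three prescribed moments over [0, p], and prescribed
values at the two ends so that the velocities match. A polynomial of degree at most four solves it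
(`momentPrimitive_one`), with coefficients depending continuously on the data.

The Whitney condition controls these data. A horizontal curve of length ℓ has group increment with
coordinates at most ℓ, ℓ, ℓ², ℓ³ (`abs_coord_le_of_isHorizontalCurve`). Hence, along pairs of
distinct points of K shrinking to t, the increments of γ, scaled by homogeneous powers of the
elapsed time, converge to those of the one-parameter subgroup with velocity Y(t)
(`tendsto_scaledIncrement`). For the limiting data the arc has constant controls (`arcU_expData`,
`arcV_expData`), so by compactness the arcs across gaps shrinking to t have controls uniformly close
to Y(t) (`tendsto_arc_controls`).

Each gap of K is filled by such an arc. An arc needs a nonzero increment of x₁; near a point of K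
this is automatic, because the scaled increment tends to a nonzero number, and the remaining gaps
may be crossed by any horizontal curve with the right end velocities (`exists_connects`). The
resulting controls are continuous. The scaled limits give the derivative relative to K, and the mean
value theorem across the gaps turns it into a full derivative (`hasDerivAt_of_gaps`). -/

/-! ### Coordinates of horizontal curves of given length -/

theorem AbsolutelyContinuousOnInterval.continuousLinearMap_comp {E : Type*} [NormedAddCommGroup E]
    [NormedSpace ℝ E] (L : E →L[ℝ] ℝ) {f : ℝ → E} {a b : ℝ}
    (hf : AbsolutelyContinuousOnInterval f a b) :
    AbsolutelyContinuousOnInterval (fun t => L (f t)) a b := by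
  refine squeeze_zero (fun _ => Finset.sum_nonneg fun _ _ => dist_nonneg) (fun P => ?_)
    (by simpa using Tendsto.const_mul ‖L‖ hf)
  rw [Finset.mul_sum]
  gcongr with i
  rw [dist_eq_norm, dist_eq_norm, ← map_sub]
  exact L.le_opNorm _

/-- The increment of an absolutely continuous function is at most the integral of a bound for its
derivative. -/
theorem AbsolutelyContinuousOnInterval.enorm_sub_le_lintegral {f : ℝ → ℝ} {φ : ℝ → ℝ≥0∞} {a b : ℝ}
    (hab : a ≤ b) (hf : AbsolutelyContinuousOnInterval f a b)
    (hφ : ∀ᵐ t ∂(volume.restrict (Icc a b)), ∃ f', HasDerivAt f f' t ∧ ‖f'‖ₑ ≤ φ t) :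
    ‖f b - f a‖ₑ ≤ ∫⁻ t in Icc a b, φ t := by
  rw [← hf.integral_deriv_eq_sub, intervalIntegral.integral_of_le hab,
    ← integral_Icc_eq_integral_Ioc]
  refine (enorm_integral_le_lintegral_enorm _).trans (lintegral_mono_ae ?_)
  filter_upwards [hφ] with t ⟨f', h, hle⟩
  rwa [h.deriv]

namespace Engel

theorem leftInvariantField_X₁_X₂ (a b : ℝ) (p : Engel) :
    leftInvariantField (a • X₁ + b • X₂) p =
      mk a b (coord 0 p * b) (coord 0 p ^ 2 / 2 * b) := by
  rw [leftInvariantField_eq]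
  apply ext_coord <;> simp [X₁, X₂]
  ring

theorem hasDerivAt_coord {γ : ℝ → Engel} {v : Engel} {t : ℝ} (h : HasDerivAt γ v t) (i : Fin 4) :
    HasDerivAt (fun s => coord i (γ s)) (coord i v) t :=
  (coord i).hasFDerivAt.comp_hasDerivAt t h

theorem hasDerivAt_iff_coord {γ : ℝ → Engel} {v : Engel} {t : ℝ} :
    HasDerivAt γ v t ↔ ∀ i, HasDerivAt (fun s => coord i (γ s)) (coord i v) t := by
  refine ⟨hasDerivAt_coord, fun h => ?_⟩
  have := hasDerivAt_mk (h 0) (h 1) (h 2) (h 3)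
  have e1 : v = mk (coord 0 v) (coord 1 v) (coord 2 v) (coord 3 v) := by
    apply ext_coord <;> simp
  have e2 : γ = fun s => mk (coord 0 (γ s)) (coord 1 (γ s)) (coord 2 (γ s)) (coord 3 (γ s)) := by
    funext s
    apply ext_coord <;> simp
  rwa [← e1, ← e2] at this

theorem IsHorizontalCurve.coord_hasDerivAt {γ : ℝ → Engel} {u : ℝ → EuclideanSpace ℝ (Fin 2)}
    {a b : ℝ} (h : IsHorizontalCurve horizontalFrame γ u a b) :
    ∀ᵐ t ∂(volume.restrict (Icc a b)),
      HasDerivAt (fun s => coord 0 (γ s)) (u t 0) t ∧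
      HasDerivAt (fun s => coord 1 (γ s)) (u t 1) t ∧
      HasDerivAt (fun s => coord 2 (γ s)) (coord 0 (γ t) * u t 1) t ∧
      HasDerivAt (fun s => coord 3 (γ s)) (coord 0 (γ t) ^ 2 / 2 * u t 1) t := by
  filter_upwards [h.2] with t ht
  have e : (∑ j, u t j • horizontalFrame j) = u t 0 • X₁ + u t 1 • X₂ := by
    simp [Fin.sum_univ_two, horizontalFrame]
  rw [HasLieDerivAt, e, leftInvariantField_X₁_X₂] at ht
  exact ⟨hasDerivAt_coord ht 0, hasDerivAt_coord ht 1, hasDerivAt_coord ht 2,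
    hasDerivAt_coord ht 3⟩

/-- After translating the start to the identity, the derivatives of the last two coordinates are (x₁
- c) u₂ and (x₁ - c)²/2 · u₂, where c is the initial value of x₁. Since x₁ stays within ℓ of c,
integrating |u₂| ≤ |u| gives the bounds. This is the half of the ball-box comparison that the proof
needs. -/
theorem abs_coord_le_of_isHorizontalCurve {γ : ℝ → Engel} {u : ℝ → EuclideanSpace ℝ (Fin 2)}
    {a b ℓ : ℝ} (hab : a ≤ b) (h : IsHorizontalCurve horizontalFrame γ u a b) (hℓ : 0 ≤ ℓ)
    (hu : ∫⁻ t in Icc a b, ‖u t‖ₑ ≤ ENNReal.ofReal ℓ) :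
    |coord 0 ((γ a)⁻¹ * γ b)| ≤ ℓ ∧ |coord 1 ((γ a)⁻¹ * γ b)| ≤ ℓ ∧
      |coord 2 ((γ a)⁻¹ * γ b)| ≤ ℓ ^ 2 ∧ |coord 3 ((γ a)⁻¹ * γ b)| ≤ ℓ ^ 3 := by
  have hd := IsHorizontalCurve.coord_hasDerivAt h
  have hac := fun i => h.1.continuousLinearMap_comp (coord i)
  have hn : ∀ t (i : Fin 2), ‖u t i‖ₑ ≤ ‖u t‖ₑ := fun t i =>
    enorm_le_iff_norm_le.2 (PiLp.norm_apply_le (u t) i)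
  have toReal : ∀ {x r : ℝ}, 0 ≤ r → ‖x‖ₑ ≤ ENNReal.ofReal r → |x| ≤ r := by
    intro x r hr hx
    rwa [← ofReal_norm, ENNReal.ofReal_le_ofReal_iff hr] at hx
  have hmul : ∀ c : ℝ, 0 ≤ c →
      ∫⁻ t in Icc a b, ENNReal.ofReal c * ‖u t‖ₑ ≤ ENNReal.ofReal (c * ℓ) := by
    intro c hc
    rw [lintegral_const_mul' _ _ ENNReal.ofReal_ne_top, ENNReal.ofReal_mul hc]
    gcongr
  have h0 : ∀ s ∈ Icc a b, |coord 0 (γ s) - coord 0 (γ a)| ≤ ℓ := by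
    intro s hs
    refine toReal hℓ (le_trans ?_ hu)
    have hsub : Icc a s ⊆ Icc a b := Icc_subset_Icc le_rfl hs.2
    refine le_trans (((hac 0).mono ?_).enorm_sub_le_lintegral hs.1
      (φ := fun t => ‖u t‖ₑ) ?_) (lintegral_mono_set hsub)
    · rwa [uIcc_of_le hs.1, uIcc_of_le hab]
    · filter_upwards [ae_restrict_of_ae_restrict_of_subset hsub hd] with t ht
      exact ⟨_, ht.1, hn t 0⟩
  have h1 : |coord 1 (γ b) - coord 1 (γ a)| ≤ ℓ := by
    refine toReal hℓ (le_trans ((hac 1).enorm_sub_le_lintegral hab ?_) hu)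
    filter_upwards [hd] with t ht
    exact ⟨_, ht.2.1, hn t 1⟩
  set c := coord 0 (γ a) with hc
  -- Subtracting c·x₂ from x₃, and below c·x₃ - (c²/2)·x₂ from x₄, gives combinations whose
  -- increments are the last two coordinates of (γ a)⁻¹ γ b.
  have h2 : |(coord 2 (γ b) - c * coord 1 (γ b)) - (coord 2 (γ a) - c * coord 1 (γ a))| ≤
      ℓ * ℓ := by
    refine toReal (by positivity) (le_trans (((hac 2).fun_sub
      ((hac 1).const_mul c)).enorm_sub_le_lintegral hab ?_) (hmul ℓ hℓ))
    filter_upwards [hd, ae_restrict_mem measurableSet_Icc] with t ht htm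
    refine ⟨_, ht.2.2.1.fun_sub (ht.2.1.const_mul c), ?_⟩
    rw [← sub_mul, enorm_mul, Real.enorm_eq_ofReal_abs (coord 0 (γ t) - c)]
    gcongr
    · exact h0 t htm
    · exact hn t 1
  have h3 : |(coord 3 (γ b) - (c * coord 2 (γ b) - c ^ 2 / 2 * coord 1 (γ b))) -
      (coord 3 (γ a) - (c * coord 2 (γ a) - c ^ 2 / 2 * coord 1 (γ a)))| ≤ ℓ ^ 2 * ℓ := by
    refine toReal (by positivity) (le_trans (((hac 3).fun_sub (((hac 2).const_mul c).fun_sub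
      ((hac 1).const_mul (c ^ 2 / 2)))).enorm_sub_le_lintegral hab ?_) (hmul (ℓ ^ 2) (by positivity)))
    filter_upwards [hd, ae_restrict_mem measurableSet_Icc] with t ht htm
    refine ⟨_, ht.2.2.2.fun_sub ((ht.2.2.1.const_mul c).fun_sub (ht.2.1.const_mul (c ^ 2 / 2))), ?_⟩
    have e : coord 0 (γ t) ^ 2 / 2 * u t 1 - (c * (coord 0 (γ t) * u t 1) - c ^ 2 / 2 * u t 1) =
        (coord 0 (γ t) - c) ^ 2 / 2 * u t 1 := by ring
    rw [e, enorm_mul, Real.enorm_eq_ofReal_abs ((coord 0 (γ t) - c) ^ 2 / 2)]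
    gcongr
    · rw [abs_of_nonneg (by positivity)]
      have := sq_le_sq' (abs_le.1 (h0 t htm)).1 (abs_le.1 (h0 t htm)).2
      linarith [sq_nonneg (coord 0 (γ t) - c)]
    · exact hn t 1
  have hb := h0 b (right_mem_Icc.2 hab)
  simp only [mul_def, inv_def, coord_mk_zero, coord_mk_one, coord_mk_two, coord_mk_three, ← hc]
  refine ⟨?_, ?_, ?_, ?_⟩
  · convert hb using 2; ring
  · convert h1 using 2; ring
  · convert h2 using 2 <;> ring
  · convert h3 using 2 <;> ring

theorem abs_coord_le_of_ccDist_lt {x y : Engel} {ℓ : ℝ}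
    (h : ccDist horizontalFrame x y < ENNReal.ofReal ℓ) :
    |coord 0 (x⁻¹ * y)| ≤ ℓ ∧ |coord 1 (x⁻¹ * y)| ≤ ℓ ∧
      |coord 2 (x⁻¹ * y)| ≤ ℓ ^ 2 ∧ |coord 3 (x⁻¹ * y)| ≤ ℓ ^ 3 := by
  have hℓ : 0 < ℓ := ENNReal.ofReal_pos.1 (bot_le.trans_lt h)
  obtain ⟨_, ⟨a, b, γ, u, hab, rfl, rfl, hh, rfl⟩, hlt⟩ := sInf_lt_iff.1 h
  exact abs_coord_le_of_isHorizontalCurve hab hh hℓ.le hlt.le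

end Engel

/-! ### The Whitney condition as convergence of scaled increments -/

theorem exists_ccDist_lt_of_tendsto_whitneyRemainder {G : Type*} [NormedAddCommGroup G]
    [NormedSpace ℝ G] [Group G] {r : ℕ} {X : Fin r → GroupLieAlgebra 𝓘(ℝ, G) G} {K : Set ℝ}
    {γ : ℝ → G} {Y : ℝ → GroupLieAlgebra 𝓘(ℝ, G) G}
    (h : Tendsto (whitneyRemainder X K γ Y) (𝓝[>] 0) (𝓝 0)) {ε : ℝ} (hε : 0 < ε) :
    ∃ η > 0, ∀ τ ∈ K, ∀ t ∈ K, τ ≠ t → |τ - t| < η →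
      ccDist X (γ t) (γ τ * lieGroupExp ((t - τ) • Y τ)) < ENNReal.ofReal (ε * |t - τ|) := by
  have h1 : ∀ᶠ η in 𝓝[>] 0, whitneyRemainder X K γ Y η < ENNReal.ofReal ε :=
    h.eventually_lt_const (by simpa using hε)
  obtain ⟨η, hη, hη0⟩ := (h1.and self_mem_nhdsWithin).exists
  refine ⟨η, hη0, fun τ hτ t ht hne hlt => ?_⟩
  have hpos : 0 < |τ - t| := abs_pos.2 (sub_ne_zero.2 hne)
  have h2 : ccDist X (γ t) (γ τ * lieGroupExp ((t - τ) • Y τ)) / ENNReal.ofReal |τ - t| ≤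
      whitneyRemainder X K γ Y η :=
    le_iSup_of_le τ (le_iSup_of_le hτ (le_iSup_of_le t (le_iSup_of_le ht
      (le_iSup_of_le hpos (le_iSup_of_le hlt le_rfl)))))
  have h3 := h2.trans_lt hη
  rw [ENNReal.div_lt_iff (Or.inl (by simpa using sub_ne_zero.2 hne)) (Or.inl ENNReal.ofReal_ne_top),
    ← ENNReal.ofReal_mul hε.le] at h3
  rwa [abs_sub_comm t τ]

namespace Engel

/-- The filter of pairs of distinct points of `K` approaching `t`. -/
def offDiagNhds (K : Set ℝ) (t : ℝ) : Filter (ℝ × ℝ) :=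
  𝓝[{z : ℝ × ℝ | z.1 ∈ K ∧ z.2 ∈ K ∧ z.1 ≠ z.2}] (t, t)

theorem eventually_offDiagNhds_mem (K : Set ℝ) (t : ℝ) :
    ∀ᶠ z in offDiagNhds K t, z.1 ∈ K ∧ z.2 ∈ K ∧ z.1 ≠ z.2 :=
  self_mem_nhdsWithin

theorem tendsto_fst_offDiagNhds (K : Set ℝ) (t : ℝ) :
    Tendsto Prod.fst (offDiagNhds K t) (𝓝[K] t) :=
  tendsto_nhdsWithin_iff.2 ⟨(continuous_fst.tendsto (t, t)).mono_left nhdsWithin_le_nhds,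
    (eventually_offDiagNhds_mem K t).mono fun _ h => h.1⟩

theorem tendsto_snd_offDiagNhds (K : Set ℝ) (t : ℝ) :
    Tendsto Prod.snd (offDiagNhds K t) (𝓝[K] t) :=
  tendsto_nhdsWithin_iff.2 ⟨(continuous_snd.tendsto (t, t)).mono_left nhdsWithin_le_nhds,
    (eventually_offDiagNhds_mem K t).mono fun _ h => h.2.1⟩

theorem tendsto_offDiagNhds {ι : Type*} {l : Filter ι} {K : Set ℝ} {t : ℝ} {α β : ι → ℝ}
    (hα : Tendsto α l (𝓝 t)) (hβ : Tendsto β l (𝓝 t))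
    (h : ∀ᶠ i in l, α i ∈ K ∧ β i ∈ K ∧ α i ≠ β i) :
    Tendsto (fun i => (α i, β i)) l (offDiagNhds K t) :=
  tendsto_nhdsWithin_iff.2 ⟨hα.prodMk_nhds hβ, h⟩

theorem tendsto_dist_offDiagNhds (K : Set ℝ) (t : ℝ) :
    Tendsto (fun z : ℝ × ℝ => |z.1 - z.2|) (offDiagNhds K t) (𝓝 0) := by
  have : Continuous fun z : ℝ × ℝ => |z.1 - z.2| := by fun_prop
  have h := (this.tendsto (t, t)).mono_left (nhdsWithin_le_nhds (s :=
    {z : ℝ × ℝ | z.1 ∈ K ∧ z.2 ∈ K ∧ z.1 ≠ z.2}))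
  rwa [sub_self, abs_zero] at h

/-- The coordinates of the group increment of `γ` between the two times `z`, divided by the
homogeneous powers of the elapsed time. -/
noncomputable def scaledIncrement (γ : ℝ → Engel) (z : ℝ × ℝ) : ℝ × ℝ × ℝ × ℝ :=
  (coord 0 ((γ z.1)⁻¹ * γ z.2) / (z.2 - z.1), coord 1 ((γ z.1)⁻¹ * γ z.2) / (z.2 - z.1),
    coord 2 ((γ z.1)⁻¹ * γ z.2) / (z.2 - z.1) ^ 2, coord 3 ((γ z.1)⁻¹ * γ z.2) / (z.2 - z.1) ^ 3)

theorem lieGroupExp_X₁_X₂ (h a b : ℝ) : lieGroupExp (h • (a • X₁ + b • X₂)) =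
    mk (h * a) (h * b) (h ^ 2 * (a * b / 2)) (h ^ 3 * (a ^ 2 * b / 6)) := by
  rw [lieGroupExp_eq]
  apply ext_coord <;> simp [X₁, X₂] <;> ring

/-- The Whitney condition determines the infinitesimal increments: they are those of the
one-parameter subgroup generated by the prescribed velocity. -/
theorem tendsto_scaledIncrement {K : Set ℝ} {γ : ℝ → Engel} {Y : ℝ → LieAlg} {a b : ℝ → ℝ}
    (hY : ∀ t ∈ K, Y t = a t • X₁ + b t • X₂) (ha : ContinuousOn a K) (hb : ContinuousOn b K)
    (h : Tendsto (whitneyRemainder horizontalFrame K γ Y) (𝓝[>] 0) (𝓝 0)) {t : ℝ} (ht : t ∈ K) :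
    Tendsto (scaledIncrement γ) (offDiagNhds K t)
      (𝓝 (a t, b t, a t * b t / 2, a t ^ 2 * b t / 6)) := by
  set l := offDiagNhds K t
  -- The error between γ at the second time and its first-order prediction from the first time. The
  -- Whitney condition makes it small in every coordinate, at that coordinate's homogeneous order.
  let e : ℝ × ℝ → Engel := fun z => (γ z.2)⁻¹ * (γ z.1 * lieGroupExp ((z.2 - z.1) • Y z.1))
  have key : ∀ ε > 0, ∀ᶠ z in l, |coord 0 (e z)| ≤ ε * |z.2 - z.1| ∧
      |coord 1 (e z)| ≤ ε * |z.2 - z.1| ∧ |coord 2 (e z)| ≤ (ε * |z.2 - z.1|) ^ 2 ∧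
      |coord 3 (e z)| ≤ (ε * |z.2 - z.1|) ^ 3 := by
    intro ε hε
    obtain ⟨η, hη, H⟩ := exists_ccDist_lt_of_tendsto_whitneyRemainder h hε
    filter_upwards [eventually_offDiagNhds_mem K t,
      (tendsto_dist_offDiagNhds K t).eventually_lt_const hη] with z hz hlt
    exact abs_coord_le_of_ccDist_lt (H _ hz.1 _ hz.2.1 hz.2.2 hlt)
  have key' : ∀ (i : Fin 4) (n : ℕ), n ≠ 0 →
      (∀ ε > 0, ∀ᶠ z in l, |coord i (e z)| ≤ (ε * |z.2 - z.1|) ^ n) →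
      Tendsto (fun z => coord i (e z) / (z.2 - z.1) ^ n) l (𝓝 0) := by
    intro i n hn H
    rw [Metric.tendsto_nhds]
    intro ε hε
    -- The cap at 1 ensures δⁿ ≤ δ < ε for every n ≥ 1.
    set δ := min (ε / 2) 1 with hδ
    have hδ0 : 0 < δ := by positivity
    filter_upwards [H δ hδ0, eventually_offDiagNhds_mem K t] with z hz hm
    have hpos : 0 < |z.2 - z.1| := abs_pos.2 (sub_ne_zero.2 hm.2.2.symm)
    rw [Real.dist_0_eq_abs, abs_div, abs_pow, div_lt_iff₀ (by positivity)]
    rw [mul_pow] at hz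
    refine hz.trans_lt ?_
    gcongr
    calc δ ^ n ≤ δ := pow_le_of_le_one hδ0.le (min_le_right _ _) hn
      _ ≤ ε / 2 := min_le_left _ _
      _ < ε := by linarith
  have e0 := key' 0 1 one_ne_zero fun ε hε => (key ε hε).mono fun z hz => by simpa using hz.1
  have e1 := key' 1 1 one_ne_zero fun ε hε => (key ε hε).mono fun z hz => by simpa using hz.2.1
  have e2 := key' 2 2 two_ne_zero fun ε hε => (key ε hε).mono fun z hz => hz.2.2.1
  have e3 := key' 3 3 three_ne_zero fun ε hε => (key ε hε).mono fun z hz => hz.2.2.2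
  have ha' : Tendsto (fun z : ℝ × ℝ => a z.1) l (𝓝 (a t)) :=
    (ha t ht).tendsto.comp (tendsto_fst_offDiagNhds K t)
  have hb' : Tendsto (fun z : ℝ × ℝ => b z.1) l (𝓝 (b t)) :=
    (hb t ht).tendsto.comp (tendsto_fst_offDiagNhds K t)
  -- The increment is exp((z.2 - z.1) Y) e⁻¹. As the group law is homogeneous, its scaled
  -- coordinates are a fixed polynomial in the velocity and in the scaled coordinates of e, so the
  -- limit is found by setting the latter to zero.
  let P : (ℝ × ℝ) × (ℝ × ℝ × ℝ × ℝ) → ℝ × ℝ × ℝ × ℝ := fun p =>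
    (p.1.1 - p.2.1, p.1.2 - p.2.2.1,
      p.1.1 * p.1.2 / 2 + p.2.1 * p.2.2.1 - p.2.2.2.1 - p.1.1 * p.2.2.1,
      p.1.1 ^ 2 * p.1.2 / 6 + p.2.1 * p.2.2.2.1 - p.2.1 ^ 2 * p.2.2.1 / 2 - p.2.2.2.2
        - p.1.1 ^ 2 * p.2.2.1 / 2 + p.1.1 * (p.2.1 * p.2.2.1 - p.2.2.2.1))
  have hP : Continuous P := by fun_prop
  have lim := (hP.tendsto ((a t, b t), (0, 0, 0, 0))).comp
    ((ha'.prodMk_nhds hb').prodMk_nhds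
      (e0.prodMk_nhds (e1.prodMk_nhds (e2.prodMk_nhds e3))))
  have hval : P ((a t, b t), (0, 0, 0, 0)) = (a t, b t, a t * b t / 2, a t ^ 2 * b t / 6) := by
    simp [P]
  rw [hval] at lim
  refine lim.congr' ?_
  filter_upwards [eventually_offDiagNhds_mem K t] with z hz
  have hne : z.2 - z.1 ≠ 0 := sub_ne_zero.2 hz.2.2.symm
  have hg : (γ z.1)⁻¹ * γ z.2 = lieGroupExp ((z.2 - z.1) • Y z.1) * (e z)⁻¹ := by
    simp only [e]; group
  rw [hY _ hz.1, lieGroupExp_X₁_X₂] at hg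
  simp only [scaledIncrement, hg, P, Function.comp]
  generalize e z = w
  simp only [mul_def, inv_def, coord_mk_zero, coord_mk_one, coord_mk_two, coord_mk_three,
    Prod.mk.injEq]
  refine ⟨?_, ?_, ?_, ?_⟩ <;> field_simp <;> ring

end Engel

/-! ### A polynomial moment problem -/

/-- The polynomial of degree at most four with value `w₀` at `0`, value `w₁` at `1`, and moments
`∫₀¹ yᵏ = μ k` for `k = 0, 1, 2`, in terms of its deviation from the affine interpolation. -/
noncomputable def momentCoeff (w₀ w₁ : ℝ) (μ : ℝ × ℝ × ℝ) : ℝ × ℝ × ℝ :=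
  let r₀ := μ.1 - w₀ - (w₁ - w₀) / 2
  let r₁ := μ.2.1 - w₀ / 2 - (w₁ - w₀) / 3
  let r₂ := μ.2.2 - w₀ / 3 - (w₁ - w₀) / 4
  -- The inverse of the matrix with entries ∫₀¹ y(1 - y) yʲ⁺ᵏ dy = 1/((j+k+2)(j+k+3)), applied to
  -- the moments left over by the affine interpolation.
  (120 * r₀ - 480 * r₁ + 420 * r₂, -480 * r₀ + 2220 * r₁ - 2100 * r₂,
    420 * r₀ - 2100 * r₁ + 2100 * r₂)

/-- The factor y(1 - y) leaves the end values alone, and the quadratic factor is free to fix the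
three moments. -/
noncomputable def momentPoly (w₀ w₁ : ℝ) (μ : ℝ × ℝ × ℝ) (y : ℝ) : ℝ :=
  w₀ + (w₁ - w₀) * y + y * (1 - y) * ((momentCoeff w₀ w₁ μ).1 + (momentCoeff w₀ w₁ μ).2.1 * y
    + (momentCoeff w₀ w₁ μ).2.2 * y ^ 2)

/-- The primitive `∫₀ʸ xᵏ P(x) dx` where `P = momentPoly w₀ w₁ μ`. -/
noncomputable def momentPrimitive (w₀ w₁ : ℝ) (μ : ℝ × ℝ × ℝ) (k : ℕ) (y : ℝ) : ℝ :=
  w₀ / (k + 1) * y ^ (k + 1) + (w₁ - w₀ + (momentCoeff w₀ w₁ μ).1) / (k + 2) * y ^ (k + 2) +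
    ((momentCoeff w₀ w₁ μ).2.1 - (momentCoeff w₀ w₁ μ).1) / (k + 3) * y ^ (k + 3) +
    ((momentCoeff w₀ w₁ μ).2.2 - (momentCoeff w₀ w₁ μ).2.1) / (k + 4) * y ^ (k + 4) -
    (momentCoeff w₀ w₁ μ).2.2 / (k + 5) * y ^ (k + 5)

theorem hasDerivAt_momentPrimitive (w₀ w₁ : ℝ) (μ : ℝ × ℝ × ℝ) (k : ℕ) (y : ℝ) :
    HasDerivAt (momentPrimitive w₀ w₁ μ k) (y ^ k * momentPoly w₀ w₁ μ y) y := by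
  have h : ∀ (n : ℕ) (c : ℝ), HasDerivAt (fun y : ℝ => c / (k + (n + 1 : ℕ)) * y ^ (k + (n + 1)))
      (c * y ^ (k + n)) y := by
    intro n c
    have := (hasDerivAt_pow (k + (n + 1)) y).const_mul (c / (k + (n + 1 : ℕ)))
    convert! this using 1
    have : (k : ℝ) + ((n : ℝ) + 1) ≠ 0 := by positivity
    push_cast
    rw [← add_assoc k n 1, Nat.add_sub_cancel]
    field_simp
  have := ((((h 0 w₀).fun_add (h 1 (w₁ - w₀ + (momentCoeff w₀ w₁ μ).1))).fun_add
    (h 2 ((momentCoeff w₀ w₁ μ).2.1 - (momentCoeff w₀ w₁ μ).1))).fun_add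
    (h 3 ((momentCoeff w₀ w₁ μ).2.2 - (momentCoeff w₀ w₁ μ).2.1))).fun_sub
    (h 4 (momentCoeff w₀ w₁ μ).2.2)
  norm_num at this
  convert! this using 1
  simp only [momentPoly]
  ring

theorem momentPrimitive_zero (w₀ w₁ : ℝ) (μ : ℝ × ℝ × ℝ) (k : ℕ) :
    momentPrimitive w₀ w₁ μ k 0 = 0 := by
  simp [momentPrimitive]

theorem momentPrimitive_one (w₀ w₁ : ℝ) (μ : ℝ × ℝ × ℝ) :
    momentPrimitive w₀ w₁ μ 0 1 = μ.1 ∧ momentPrimitive w₀ w₁ μ 1 1 = μ.2.1 ∧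
      momentPrimitive w₀ w₁ μ 2 1 = μ.2.2 := by
  simp only [momentPrimitive, momentCoeff]
  refine ⟨?_, ?_, ?_⟩ <;> norm_num <;> ring

theorem momentPoly_zero (w₀ w₁ : ℝ) (μ : ℝ × ℝ × ℝ) : momentPoly w₀ w₁ μ 0 = w₀ := by
  simp [momentPoly]

theorem momentPoly_one (w₀ w₁ : ℝ) (μ : ℝ × ℝ × ℝ) : momentPoly w₀ w₁ μ 1 = w₁ := by
  simp [momentPoly]

/-- The data are those of a constant, so the leftover moments vanish and there is no correction.
This is what makes arcs degenerate to constant velocity. -/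
theorem momentPoly_const (w y : ℝ) : momentPoly w w (w, w / 2, w / 3) y = w := by
  simp [momentPoly, momentCoeff]

/-! ### Connecting arcs and their controls -/

namespace Engel

/-- `Γ` is a horizontal curve with continuous controls `u` and `v`, defined for all times. -/
structure IsSmoothHorizontal (Γ : ℝ → Engel) (u v : ℝ → ℝ) : Prop where
  continuous_fst : Continuous u
  continuous_snd : Continuous v
  hasDerivAt : ∀ s, HasDerivAt Γ
    (mk (u s) (v s) (coord 0 (Γ s) * v s) (coord 0 (Γ s) ^ 2 / 2 * v s)) s

theorem IsSmoothHorizontal.left_mul {Γ : ℝ → Engel} {u v : ℝ → ℝ} (h : IsSmoothHorizontal Γ u v)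
    (p : Engel) : IsSmoothHorizontal (fun s => p * Γ s) u v := by
  refine ⟨h.1, h.2, fun s => ?_⟩
  have h1 := ((leftLinear p).hasFDerivAt.comp_hasDerivAt s (h.hasDerivAt s)).const_add p
  convert! h1 using 1
  · funext s
    exact mul_eq_add_leftLinear p _
  · apply ext_coord <;> simp [leftLinear_apply, mul_def] <;> ring

/-- First control of the connecting arc on `[0, 1]`. The data are the initial and final velocities
and the scaled group increment. -/
noncomputable def arcU (d : (ℝ × ℝ) × (ℝ × ℝ) × (ℝ × ℝ × ℝ × ℝ)) (σ : ℝ) : ℝ :=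
  -- The bump 6σ(1 - σ) vanishes at both ends and has integral one, so it adjusts the total
  -- displacement without changing the end velocities.
  d.1.1 + (d.2.1.1 - d.1.1) * σ + 6 * (d.2.2.1 - (d.1.1 + d.2.1.1) / 2) * (σ * (1 - σ))

/-- The primitive of `arcU d`. -/
noncomputable def arcX (d : (ℝ × ℝ) × (ℝ × ℝ) × (ℝ × ℝ × ℝ × ℝ)) (σ : ℝ) : ℝ :=
  d.1.1 * σ + (d.2.1.1 - d.1.1) / 2 * σ ^ 2
    + 6 * (d.2.2.1 - (d.1.1 + d.2.1.1) / 2) * (σ ^ 2 / 2 - σ ^ 3 / 3)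

/-- The moments that the slope of the connecting arc must have. -/
noncomputable def arcMoments (d : (ℝ × ℝ) × (ℝ × ℝ) × (ℝ × ℝ × ℝ × ℝ)) : ℝ × ℝ × ℝ :=
  -- With x₁ = p y the end point has x₂ = p ∫P, x₃ = p² ∫yP and x₄ = (p³/2) ∫y²P, the integrals
  -- being over [0, 1].
  (d.2.2.2.1 / d.2.2.1, d.2.2.2.2.1 / d.2.2.1 ^ 2, 2 * d.2.2.2.2.2 / d.2.2.1 ^ 3)

/-- Second control of the connecting arc on `[0, 1]`. -/
noncomputable def arcV (d : (ℝ × ℝ) × (ℝ × ℝ) × (ℝ × ℝ × ℝ × ℝ)) (σ : ℝ) : ℝ :=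
  momentPoly (d.1.2 / d.1.1) (d.2.1.2 / d.2.1.1) (arcMoments d) (arcX d σ / d.2.2.1) * arcU d σ

theorem hasDerivAt_arcX (d : (ℝ × ℝ) × (ℝ × ℝ) × (ℝ × ℝ × ℝ × ℝ)) (σ : ℝ) :
    HasDerivAt (arcX d) (arcU d σ) σ := by
  have h1 := hasDerivAt_id σ
  have h2 := hasDerivAt_pow 2 σ
  have h3 := hasDerivAt_pow 3 σ
  have := ((h1.const_mul d.1.1).fun_add (h2.const_mul ((d.2.1.1 - d.1.1) / 2))).fun_add
    (((h2.div_const 2).fun_sub (h3.div_const 3)).const_mul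
      (6 * (d.2.2.1 - (d.1.1 + d.2.1.1) / 2)))
  convert! this using 1
  simp [arcU]
  ring

theorem arcX_zero (d : (ℝ × ℝ) × (ℝ × ℝ) × (ℝ × ℝ × ℝ × ℝ)) : arcX d 0 = 0 := by
  simp [arcX]

theorem arcX_one (d : (ℝ × ℝ) × (ℝ × ℝ) × (ℝ × ℝ × ℝ × ℝ)) : arcX d 1 = d.2.2.1 := by
  simp only [arcX]; ring

/-- The connecting arc, run in time `h`. -/
noncomputable def arc (d : (ℝ × ℝ) × (ℝ × ℝ) × (ℝ × ℝ × ℝ × ℝ)) (h s : ℝ) : Engel :=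
  let V := momentPrimitive (d.1.2 / d.1.1) (d.2.1.2 / d.2.1.1) (arcMoments d)
  let y := arcX d (s / h) / d.2.2.1
  mk (h * arcX d (s / h)) (h * d.2.2.1 * V 0 y) (h ^ 2 * d.2.2.1 ^ 2 * V 1 y)
    (h ^ 3 * d.2.2.1 ^ 3 / 2 * V 2 y)

/-- The last three coordinates are primitives of P, yP, y²P composed with x₁, so the chain rule
gives the horizontality relations. The first control may vanish or change sign: x₁ need not be
monotone. -/
theorem isSmoothHorizontal_arc {d : (ℝ × ℝ) × (ℝ × ℝ) × (ℝ × ℝ × ℝ × ℝ)} (hd : d.2.2.1 ≠ 0) {h : ℝ}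
    (hh : h ≠ 0) (α : ℝ) : IsSmoothHorizontal (fun s => arc d h (s - α))
      (fun s => arcU d ((s - α) / h)) (fun s => arcV d ((s - α) / h)) := by
  refine ⟨?_, ?_, fun s => ?_⟩
  · unfold arcU; fun_prop
  · unfold arcV momentPoly arcX arcU; fun_prop
  · have hσ : HasDerivAt (fun s : ℝ => (s - α) / h) (1 / h) s :=
      ((hasDerivAt_id s).sub_const α).div_const h
    have hX : HasDerivAt (fun s : ℝ => arcX d ((s - α) / h)) (arcU d ((s - α) / h) * (1 / h)) s :=
      HasDerivAt.comp (h := fun s => (s - α) / h) s (hasDerivAt_arcX d ((s - α) / h)) hσ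
    have hV := fun k => HasDerivAt.comp (h := fun s => arcX d ((s - α) / h) / d.2.2.1) s
      (hasDerivAt_momentPrimitive (d.1.2 / d.1.1) (d.2.1.2 / d.2.1.1) (arcMoments d) k
        (arcX d ((s - α) / h) / d.2.2.1)) (hX.div_const d.2.2.1)
    have := hasDerivAt_mk (hX.const_mul h) ((hV 0).const_mul (h * d.2.2.1))
      ((hV 1).const_mul (h ^ 2 * d.2.2.1 ^ 2)) ((hV 2).const_mul (h ^ 3 * d.2.2.1 ^ 3 / 2))
    convert! this using 1
    simp only [arc, arcV]
    apply ext_coord <;> simp only [coord_mk_zero, coord_mk_one, coord_mk_two, coord_mk_three] <;>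
      field_simp

theorem arc_zero (d : (ℝ × ℝ) × (ℝ × ℝ) × (ℝ × ℝ × ℝ × ℝ)) (h : ℝ) : arc d h 0 = 1 := by
  simp [arc, arcX_zero, momentPrimitive_zero, one_def]

theorem arc_self {d : (ℝ × ℝ) × (ℝ × ℝ) × (ℝ × ℝ × ℝ × ℝ)} (hd : d.2.2.1 ≠ 0) {h : ℝ}
    (hh : h ≠ 0) : arc d h h = mk (h * d.2.2.1) (h * d.2.2.2.1) (h ^ 2 * d.2.2.2.2.1)
      (h ^ 3 * d.2.2.2.2.2) := by
  obtain ⟨h0, h1, h2⟩ := momentPrimitive_one (d.1.2 / d.1.1) (d.2.1.2 / d.2.1.1) (arcMoments d)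
  simp only [arc, div_self hh, arcX_one, div_self hd, h0, h1, h2]
  simp only [arcMoments]
  congr 1 <;> field_simp

theorem arcU_zero (d : (ℝ × ℝ) × (ℝ × ℝ) × (ℝ × ℝ × ℝ × ℝ)) : arcU d 0 = d.1.1 := by
  simp [arcU]

theorem arcU_one (d : (ℝ × ℝ) × (ℝ × ℝ) × (ℝ × ℝ × ℝ × ℝ)) : arcU d 1 = d.2.1.1 := by
  simp [arcU]

theorem arcV_zero {d : (ℝ × ℝ) × (ℝ × ℝ) × (ℝ × ℝ × ℝ × ℝ)} (h : d.1.1 ≠ 0) :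
    arcV d 0 = d.1.2 := by
  simp [arcV, arcX_zero, arcU_zero, momentPoly_zero, h]

theorem arcV_one {d : (ℝ × ℝ) × (ℝ × ℝ) × (ℝ × ℝ × ℝ × ℝ)} (h : d.2.1.1 ≠ 0) (hd : d.2.2.1 ≠ 0) :
    arcV d 1 = d.2.1.2 := by
  simp [arcV, arcX_one, arcU_one, momentPoly_one, h, hd]

/-- If `F` is continuous along `{p₀} × C` with `C` compact, and constant there, then it is close to
that constant near `p₀`, uniformly over `C`. -/
theorem _root_.tendsto_of_continuousAt_prod_compact {P S Z ι : Type*} [TopologicalSpace P]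
    [TopologicalSpace S] [TopologicalSpace Z] {F : P × S → Z} {p₀ : P} {C : Set S} {w : Z}
    (hC : IsCompact C) (hF : ∀ σ ∈ C, ContinuousAt F (p₀, σ)) (hw : ∀ σ ∈ C, F (p₀, σ) = w)
    {l : Filter ι} {p : ι → P} {σ : ι → S} (hp : Tendsto p l (𝓝 p₀)) (hσ : ∀ᶠ i in l, σ i ∈ C) :
    Tendsto (fun i => F (p i, σ i)) l (𝓝 w) := by
  refine (tendsto_iff_ultrafilter _ _ _).2 fun g hg => ?_
  obtain ⟨σ₀, h₀, hle⟩ := hC.ultrafilter_le_nhds (g.map σ) (le_principal_iff.2 (hg hσ))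
  have h1 : Tendsto (fun i => (p i, σ i)) g (𝓝 (p₀, σ₀)) :=
    (hp.mono_left hg).prodMk_nhds hle
  have h2 := (hF σ₀ h₀).tendsto.comp h1
  rwa [hw σ₀ h₀] at h2

/-- The scaled group increment of a curve with constant velocity. -/
noncomputable def expData (w : ℝ × ℝ) : (ℝ × ℝ) × (ℝ × ℝ) × (ℝ × ℝ × ℝ × ℝ) :=
  (w, w, (w.1, w.2, w.1 * w.2 / 2, w.1 ^ 2 * w.2 / 6))

theorem arcU_expData (w : ℝ × ℝ) (σ : ℝ) : arcU (expData w) σ = w.1 := by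
  simp [arcU, expData]

/-- The scaled increment of a one-parameter subgroup has exactly the moments of the constant slope
w.2 / w.1. -/
theorem arcV_expData {w : ℝ × ℝ} (hw : w.1 ≠ 0) (σ : ℝ) : arcV (expData w) σ = w.2 := by
  have e1 : arcMoments (expData w) = (w.2 / w.1, w.2 / w.1 / 2, w.2 / w.1 / 3) := by
    simp only [arcMoments, expData, Prod.mk.injEq]
    refine ⟨trivial, ?_, ?_⟩ <;> field_simp
    ring
  rw [arcV, arcU_expData, e1, expData, momentPoly_const]
  field_simp

/-- The controls are continuous at the limiting data, where every denominator equals w.1 ≠ 0, and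
constant in σ there. Compactness of [0, 1] makes the convergence uniform in σ, so σ may vary freely
with the index. -/
theorem tendsto_arc_controls {ι : Type*} {l : Filter ι} {w : ℝ × ℝ} (hw : w.1 ≠ 0)
    {d : ι → (ℝ × ℝ) × (ℝ × ℝ) × (ℝ × ℝ × ℝ × ℝ)} {σ : ι → ℝ}
    (hd : Tendsto d l (𝓝 (expData w))) (hσ : ∀ᶠ i in l, σ i ∈ Icc (0 : ℝ) 1) :
    Tendsto (fun i => arcU (d i) (σ i)) l (𝓝 w.1) ∧
      Tendsto (fun i => arcV (d i) (σ i)) l (𝓝 w.2) := by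
  constructor
  · refine tendsto_of_continuousAt_prod_compact (F := fun z => arcU z.1 z.2)
      isCompact_Icc (fun σ _ => ?_) (fun σ _ => arcU_expData w σ) hd hσ
    apply Continuous.continuousAt
    unfold arcU; fun_prop
  · refine tendsto_of_continuousAt_prod_compact (F := fun z => arcV z.1 z.2)
      isCompact_Icc (fun σ _ => ?_) (fun σ _ => arcV_expData hw σ) hd hσ
    simp only [arcV, momentPoly, momentCoeff, arcMoments, arcX, arcU]
    fun_prop (disch := simp [hw])

end Engel

/-! ### Horizontal curves with prescribed ends and velocities -/

theorem hasDerivAt_ite_le {E : Type*} [NormedAddCommGroup E] [NormedSpace ℝ E] {f g f' g' : ℝ → E}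
    {m : ℝ} (hf : ∀ s, HasDerivAt f (f' s) s) (hg : ∀ s, HasDerivAt g (g' s) s)
    (h : f m = g m) (h' : f' m = g' m) (s : ℝ) :
    HasDerivAt (fun s => if s ≤ m then f s else g s) (if s ≤ m then f' s else g' s) s := by
  rcases lt_trichotomy s m with hs | rfl | hs
  · rw [if_pos hs.le]
    refine (hf s).congr_of_eventuallyEq ?_
    filter_upwards [Iio_mem_nhds hs] with r hr
    exact if_pos (le_of_lt hr)
  · rw [if_pos le_rfl]
    have h1 : HasDerivWithinAt (fun r => if r ≤ s then f r else g r) (f' s) (Iic s) s :=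
      (hf s).hasDerivWithinAt.congr (fun r hr => if_pos hr) (if_pos le_rfl)
    have h2 : HasDerivWithinAt (fun r => if r ≤ s then f r else g r) (f' s) (Ici s) s := by
      rw [h']
      refine (hg s).hasDerivWithinAt.congr (fun r hr => ?_) ((if_pos le_rfl).trans h)
      rcases (mem_Ici.1 hr).eq_or_lt with rfl | hr
      · exact (if_pos le_rfl).trans h
      · exact if_neg (not_le.2 hr)
    simpa using h1.union h2
  · rw [if_neg (not_le.2 hs)]
    refine (hg s).congr_of_eventuallyEq ?_
    filter_upwards [Ioi_mem_nhds hs] with r hr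
    exact if_neg (not_le.2 hr)

namespace Engel

/-- `Γ` is a horizontal curve with controls `u` and `v`, with prescribed positions `x`, `y` and
prescribed velocities `w`, `w'` at the times `α` and `β`. -/
structure Connects (Γ : ℝ → Engel) (u v : ℝ → ℝ) (α β : ℝ) (x y : Engel) (w w' : ℝ × ℝ) :
    Prop where
  horizontal : IsSmoothHorizontal Γ u v
  left_pt : Γ α = x
  right_pt : Γ β = y
  left_fst : u α = w.1
  left_snd : v α = w.2
  right_fst : u β = w'.1
  right_snd : v β = w'.2

theorem Connects.trans {Γ Δ : ℝ → Engel} {u v u' v' : ℝ → ℝ} {α m β : ℝ} {x z y : Engel}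
    {w₀ w w₁ : ℝ × ℝ} (hΓ : Connects Γ u v α m x z w₀ w) (hΔ : Connects Δ u' v' m β z y w w₁)
    (h₁ : α ≤ m) (h₂ : m < β) :
    Connects (fun s => if s ≤ m then Γ s else Δ s) (fun s => if s ≤ m then u s else u' s)
      (fun s => if s ≤ m then v s else v' s) α β x y w₀ w₁ := by
  have hp : Γ m = Δ m := hΓ.right_pt.trans hΔ.left_pt.symm
  have hu : u m = u' m := hΓ.right_fst.trans hΔ.left_fst.symm
  have hv : v m = v' m := hΓ.right_snd.trans hΔ.left_snd.symm
  refine ⟨⟨?_, ?_, fun s => ?_⟩, ?_, ?_, ?_, ?_, ?_, ?_⟩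
  · refine hΓ.horizontal.1.if_le hΔ.horizontal.1 continuous_id continuous_const ?_
    rintro s rfl; exact hu
  · refine hΓ.horizontal.2.if_le hΔ.horizontal.2 continuous_id continuous_const ?_
    rintro s rfl; exact hv
  · have := hasDerivAt_ite_le hΓ.horizontal.3 hΔ.horizontal.3 hp (by rw [hp, hu, hv]) s
    convert! this using 1
    split_ifs <;> rfl
  all_goals simp only [h₁, if_true, not_le.2 h₂, if_false]
  exacts [hΓ.2, hΔ.3, hΓ.4, hΓ.5, hΔ.6, hΔ.7]

/-- The data of the arc running from `x` to `y` in time `h`, with velocities `w`, `w'` at the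
ends. -/
noncomputable def arcData (x y : Engel) (w w' : ℝ × ℝ) (h : ℝ) :
    (ℝ × ℝ) × (ℝ × ℝ) × (ℝ × ℝ × ℝ × ℝ) :=
  (w, w', (coord 0 (x⁻¹ * y) / h, coord 1 (x⁻¹ * y) / h, coord 2 (x⁻¹ * y) / h ^ 2,
    coord 3 (x⁻¹ * y) / h ^ 3))

theorem connects_arc {α β : ℝ} (hαβ : α < β) {x y : Engel} {w w' : ℝ × ℝ} (hw : w.1 ≠ 0)
    (hw' : w'.1 ≠ 0) (hxy : coord 0 (x⁻¹ * y) ≠ 0) :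
    Connects (fun s => x * arc (arcData x y w w' (β - α)) (β - α) (s - α))
      (fun s => arcU (arcData x y w w' (β - α)) ((s - α) / (β - α)))
      (fun s => arcV (arcData x y w w' (β - α)) ((s - α) / (β - α))) α β x y w w' := by
  have hh : β - α ≠ 0 := (sub_pos.2 hαβ).ne'
  have hd : (arcData x y w w' (β - α)).2.2.1 ≠ 0 := div_ne_zero hxy hh
  refine ⟨(isSmoothHorizontal_arc hd hh α).left_mul x, ?_, ?_, ?_, ?_, ?_, ?_⟩
  · simp [arc_zero]
  · rw [arc_self hd hh, ← mul_inv_cancel_left x y, mul_right_inj]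
    apply ext_coord <;> simp [arcData] <;> field_simp
  · simp [arcU_zero, arcData]
  · rw [sub_self, zero_div, arcV_zero (by exact hw), arcData]
  · rw [div_self hh, arcU_one, arcData]
  · rw [div_self hh, arcV_one (by exact hw') hd, arcData]

/-- When the increment of x₁ vanishes, a detour through a point with another first coordinate splits
the path into two genuine arcs. No estimate is kept: such gaps do not occur arbitrarily close to a
point of K at which gaps accumulate. -/
theorem exists_connects {α β : ℝ} (hαβ : α < β) (x y : Engel) {w w' : ℝ × ℝ} (hw : w.1 ≠ 0)
    (hw' : w'.1 ≠ 0) : ∃ Γ u v, Connects Γ u v α β x y w w' := by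
  by_cases hxy : coord 0 (x⁻¹ * y) = 0
  · have h1 : coord 0 (x⁻¹ * (x * mk 1 0 0 0)) ≠ 0 := by simp
    have h2 : coord 0 ((x * mk 1 0 0 0)⁻¹ * y) ≠ 0 := by
      simp only [mul_def, inv_def, coord_mk_zero] at hxy ⊢
      intro h
      linarith
    have hl : α < (α + β) / 2 := by linarith
    have hr : (α + β) / 2 < β := by linarith
    exact ⟨_, _, _, (connects_arc hl (w' := (1, 0)) hw one_ne_zero h1).trans
      (connects_arc hr one_ne_zero hw' h2) hl.le hr⟩
  · exact ⟨_, _, _, connects_arc hαβ hw hw' hxy⟩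

theorem exists_connects_self (α : ℝ) (x : Engel) {w : ℝ × ℝ} (hw : w.1 ≠ 0) :
    ∃ Γ, Connects Γ (fun _ => w.1) (fun _ => w.2) α α x x w w := by
  have h := (isSmoothHorizontal_arc (d := expData w) hw one_ne_zero α).left_mul x
  simp only [arcU_expData, arcV_expData hw] at h
  exact ⟨_, h, by simp [arc_zero], by simp [arc_zero], rfl, rfl, rfl, rfl⟩

/-- Between any two times there is a connecting curve, chosen to have constant velocity if the times
agree, and to be the arc whenever that is possible. -/
theorem exists_connects_arc {α β : ℝ} (hαβ : α ≤ β) {x y : Engel} {w w' : ℝ × ℝ} (hw : w.1 ≠ 0)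
    (hw' : w'.1 ≠ 0) (hx : α = β → x = y) (hww : α = β → w = w') :
    ∃ Γ u v, Connects Γ u v α β x y w w' ∧ (α = β → ∀ s, u s = w.1 ∧ v s = w.2) ∧
      (α < β → coord 0 (x⁻¹ * y) ≠ 0 → ∀ s,
        u s = arcU (arcData x y w w' (β - α)) ((s - α) / (β - α)) ∧
        v s = arcV (arcData x y w w' (β - α)) ((s - α) / (β - α))) := by
  rcases hαβ.eq_or_lt with rfl | hlt
  · obtain rfl := hx rfl
    obtain rfl := hww rfl
    obtain ⟨Γ, hΓ⟩ := exists_connects_self α x hw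
    exact ⟨Γ, _, _, hΓ, fun _ _ => ⟨rfl, rfl⟩, fun h => absurd h (lt_irrefl _)⟩
  · by_cases hxy : coord 0 (x⁻¹ * y) = 0
    · obtain ⟨Γ, u, v, h⟩ := exists_connects hlt x y hw hw'
      exact ⟨Γ, u, v, h, fun e => absurd e hlt.ne, fun _ h => absurd hxy h⟩
    · exact ⟨_, _, _, connects_arc hlt hw hw' hxy, fun e => absurd e hlt.ne,
        fun _ _ _ => ⟨rfl, rfl⟩⟩

end Engel

/-! ### Differentiability across the gaps of a closed set -/

/-- To reach s in a gap, go from t to the last point α of K before s, using the derivative relative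
to K, and then from α to s by the mean value theorem, using the continuity of u at t. The two errors
are at most ε(α - t) and ε(s - α), which add up to ε(s - t). -/
theorem hasDerivWithinAt_Ici_of_gaps {K : Set ℝ} (hK : IsClosed K) {f u : ℝ → ℝ}
    (hgap : ∀ s, s ∉ K → HasDerivAt f (u s) s)
    (hcont : ∀ t ∈ K, ∀ r > t, (∀ s ∈ Ioo t r, s ∉ K) → ContinuousWithinAt f (Ici t) t) {t : ℝ}
    (ht : t ∈ K) (hu : ContinuousAt u t) (hf : HasDerivWithinAt f (u t) K t) :
    HasDerivWithinAt f (u t) (Ici t) t := by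
  rw [hasDerivWithinAt_iff_isLittleO, Asymptotics.isLittleO_iff] at hf ⊢
  intro ε hε
  obtain ⟨δ₁, hδ₁, H₁⟩ := Metric.mem_nhdsWithin_iff.1 (hf hε)
  obtain ⟨δ₂, hδ₂, H₂⟩ := Metric.continuousAt_iff.1 hu ε hε
  have hδ : 0 < min δ₁ δ₂ := lt_min hδ₁ hδ₂
  refine Metric.mem_nhdsWithin_iff.2 ⟨min δ₁ δ₂, hδ, ?_⟩
  rintro s ⟨hs, hts⟩
  rw [mem_Ici] at hts
  rw [Metric.mem_ball, Real.dist_eq, abs_of_nonneg (sub_nonneg.2 hts)] at hs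
  have onK : ∀ k ∈ K, t ≤ k → k ≤ s → ‖f k - f t - (k - t) • u t‖ ≤ ε * ‖k - t‖ := by
    intro k hk h1 h2
    refine H₁ ⟨?_, hk⟩
    rw [Metric.mem_ball, Real.dist_eq, abs_of_nonneg (sub_nonneg.2 h1)]
    linarith [min_le_left δ₁ δ₂]
  by_cases hsK : s ∈ K
  · exact onK s hsK hts le_rfl
  · have hne : (K ∩ Icc t s).Nonempty := ⟨t, ht, le_rfl, hts⟩
    obtain ⟨α, ⟨hαK, htα, hαs⟩, hα⟩ :=
      (isCompact_Icc.inter_left hK).exists_isGreatest hne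
    have hlt : α < s := hαs.lt_of_ne (by rintro rfl; exact hsK hαK)
    have hfree : ∀ r, α < r → r ≤ s → r ∉ K := fun r h1 h2 h3 =>
      h1.not_ge (hα ⟨h3, htα.trans h1.le, h2⟩)
    have hc : ContinuousOn f (Icc α s) := by
      intro r hr
      rcases hr.1.eq_or_lt with rfl | h
      · exact (hcont α hαK s hlt fun r hr => hfree r hr.1 hr.2.le).mono Icc_subset_Ici_self
      · exact (hgap r (hfree r h hr.2)).continuousAt.continuousWithinAt
    obtain ⟨c, hc, hslope⟩ := exists_hasDerivAt_eq_slope f u hlt hc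
      fun r hr => hgap r (hfree r hr.1 hr.2.le)
    rw [eq_div_iff (sub_pos.2 hlt).ne'] at hslope
    have h1 := onK α hαK htα hαs
    have h2 : |u c - u t| ≤ ε := by
      refine le_of_lt (H₂ ?_)
      rw [Real.dist_eq, abs_of_nonneg (by linarith [hc.1])]
      linarith [hc.2, min_le_right δ₁ δ₂]
    simp only [Real.norm_eq_abs, smul_eq_mul] at h1
    change |f s - f t - (s - t) * u t| ≤ ε * |s - t|
    rw [abs_of_nonneg (sub_nonneg.2 htα)] at h1
    rw [abs_of_nonneg (sub_nonneg.2 hts)]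
    have e : f s - f t - (s - t) * u t =
        (f α - f t - (α - t) * u t) + (u c - u t) * (s - α) := by linarith
    rw [e]
    refine (abs_add_le _ _).trans ?_
    rw [abs_mul, abs_of_pos (sub_pos.2 hlt)]
    nlinarith [mul_le_mul_of_nonneg_right h2 (sub_pos.2 hlt).le]

/-- A function which has derivative `u` off a closed set `K` and, relative to `K`, on `K`, has
derivative `u` everywhere, provided that `u` is continuous and that the function is continuous up to
the ends of the gaps of `K`. -/
theorem hasDerivAt_of_gaps {K : Set ℝ} (hK : IsClosed K) {f u : ℝ → ℝ} (hu : Continuous u)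
    (hf : ∀ t ∈ K, HasDerivWithinAt f (u t) K t) (hgap : ∀ s, s ∉ K → HasDerivAt f (u s) s)
    (hright : ∀ t ∈ K, ∀ r > t, (∀ s ∈ Ioo t r, s ∉ K) → ContinuousWithinAt f (Ici t) t)
    (hleft : ∀ t ∈ K, ∀ r < t, (∀ s ∈ Ioo r t, s ∉ K) → ContinuousWithinAt f (Iic t) t) (t : ℝ) :
    HasDerivAt f (u t) t := by
  by_cases ht : t ∈ K
  swap
  · exact hgap t ht
  have h1 := hasDerivWithinAt_Ici_of_gaps hK hgap hright ht hu.continuousAt (hf t ht)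
  -- The left derivative follows from the right one for the reflected function s ↦ f(-s) and the
  -- reflected set.
  have h2 : HasDerivWithinAt f (u t) (Iic t) t := by
    have := hasDerivWithinAt_Ici_of_gaps (K := Neg.neg ⁻¹' K) (f := fun s => f (-s))
      (u := fun s => -u (-s)) (t := -t) (hK.preimage continuous_neg) ?_ ?_ (by simpa using ht)
      (by fun_prop) ?_
    · have h3 := HasDerivWithinAt.scomp (h := fun s : ℝ => -s) (s := Iic t) t this
        (hasDerivAt_neg t).hasDerivWithinAt (fun s hs => by simpa using hs)
      simpa [Function.comp_def] using h3
    · intro s hs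
      have h3 := HasDerivAt.scomp (h := fun s : ℝ => -s) s (hgap (-s) hs) (hasDerivAt_neg s)
      simpa [Function.comp_def] using h3
    · intro s hs r hr hfree
      have := hleft (-s) hs (-r) (neg_lt_neg hr) fun q hq hqK =>
        hfree (-q) ⟨by linarith [hq.2], by linarith [hq.1]⟩ (by simpa using hqK)
      exact ContinuousWithinAt.comp (f := fun s : ℝ => -s) (t := Iic (-s)) this
        continuous_neg.continuousWithinAt
        (fun q hq => by simpa using hq)
    · have h3 := HasDerivWithinAt.scomp (h := fun s : ℝ => -s) (s := Neg.neg ⁻¹' K) (-t)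
        (g₁ := f) (t' := K) (g₁' := u t) (by simpa using hf t ht)
        (hasDerivAt_neg (-t)).hasDerivWithinAt (fun s hs => hs)
      simpa [Function.comp_def] using h3
  simpa using h2.union h1

/-! ### The ends of the gaps of a compact set -/

/-- The left end of the closure of the gap of `K` containing `s`; the nearest point of `K` if
that gap is unbounded. -/
noncomputable def gapLeft (K : Set ℝ) (s : ℝ) : ℝ := sSup (K ∩ Iic (max s (sInf K)))

/-- The right end of the closure of the gap of `K` containing `s`; the nearest point of `K` if
that gap is unbounded. -/
noncomputable def gapRight (K : Set ℝ) (s : ℝ) : ℝ := sInf (K ∩ Ici (min s (sSup K)))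

theorem isGreatest_gapLeft {K : Set ℝ} (hK : IsCompact K) (hne : K.Nonempty) (s : ℝ) :
    IsGreatest (K ∩ Iic (max s (sInf K))) (gapLeft K s) :=
  (hK.inter_right isClosed_Iic).isGreatest_sSup
    ⟨sInf K, hK.sInf_mem hne, mem_Iic.2 (le_max_right _ _)⟩

theorem isLeast_gapRight {K : Set ℝ} (hK : IsCompact K) (hne : K.Nonempty) (s : ℝ) :
    IsLeast (K ∩ Ici (min s (sSup K))) (gapRight K s) :=
  (hK.inter_right isClosed_Ici).isLeast_sInf
    ⟨sSup K, hK.sSup_mem hne, mem_Ici.2 (min_le_right _ _)⟩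

theorem gapLeft_mem {K : Set ℝ} (hK : IsCompact K) (hne : K.Nonempty) (s : ℝ) :
    gapLeft K s ∈ K :=
  (isGreatest_gapLeft hK hne s).1.1

theorem gapRight_mem {K : Set ℝ} (hK : IsCompact K) (hne : K.Nonempty) (s : ℝ) :
    gapRight K s ∈ K :=
  (isLeast_gapRight hK hne s).1.1

theorem le_gapLeft {K : Set ℝ} (hK : IsCompact K) (hne : K.Nonempty) {s k : ℝ} (hk : k ∈ K)
    (hks : k ≤ s) : k ≤ gapLeft K s :=
  (isGreatest_gapLeft hK hne s).2 ⟨hk, hks.trans (le_max_left _ _)⟩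

theorem gapRight_le {K : Set ℝ} (hK : IsCompact K) (hne : K.Nonempty) {s k : ℝ} (hk : k ∈ K)
    (hks : s ≤ k) : gapRight K s ≤ k :=
  (isLeast_gapRight hK hne s).2 ⟨hk, (min_le_left _ _).trans hks⟩

theorem gapLeft_le {K : Set ℝ} (hK : IsCompact K) (hne : K.Nonempty) {s k : ℝ} (hk : k ∈ K)
    (hks : k ≤ s) : gapLeft K s ≤ s := by
  have h := (isGreatest_gapLeft hK hne s).1.2
  rwa [mem_Iic, max_eq_left ((csInf_le hK.bddBelow hk).trans hks)] at h

theorem le_gapRight {K : Set ℝ} (hK : IsCompact K) (hne : K.Nonempty) {s k : ℝ} (hk : k ∈ K)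
    (hks : s ≤ k) : s ≤ gapRight K s := by
  have h := (isLeast_gapRight hK hne s).1.2
  rwa [mem_Ici, min_eq_left (hks.trans (le_csSup hK.bddAbove hk))] at h

theorem gapLeft_le_gapRight {K : Set ℝ} (hK : IsCompact K) (hne : K.Nonempty) (s : ℝ) :
    gapLeft K s ≤ gapRight K s := by
  have hl := gapLeft_mem hK hne s
  have hr := gapRight_mem hK hne s
  have h1 := (isGreatest_gapLeft hK hne s).1.2
  have h2 := (isLeast_gapRight hK hne s).1.2
  rcases le_total s (sInf K) with h | h
  · rw [mem_Iic, max_eq_right h] at h1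
    exact h1.trans (csInf_le hK.bddBelow hr)
  · rcases le_total s (sSup K) with h' | h'
    · rw [mem_Iic, max_eq_left h] at h1
      rw [mem_Ici, min_eq_left h'] at h2
      exact h1.trans h2
    · rw [mem_Ici, min_eq_right h'] at h2
      exact (le_csSup hK.bddAbove hl).trans h2

theorem gapLeft_eq_self {K : Set ℝ} (hK : IsCompact K) (hne : K.Nonempty) {s : ℝ}
    (hs : s ∈ K) : gapLeft K s = s :=
  le_antisymm (gapLeft_le hK hne hs le_rfl) (le_gapLeft hK hne hs le_rfl)

theorem gapRight_eq_self {K : Set ℝ} (hK : IsCompact K) (hne : K.Nonempty) {s : ℝ}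
    (hs : s ∈ K) : gapRight K s = s :=
  le_antisymm (gapRight_le hK hne hs le_rfl) (le_gapRight hK hne hs le_rfl)

theorem gapLeft_congr {K : Set ℝ} {s s' : ℝ} (h : ∀ k ∈ K, k ≤ s ↔ k ≤ s') :
    gapLeft K s = gapLeft K s' := by
  have : K ∩ Iic (max s (sInf K)) = K ∩ Iic (max s' (sInf K)) := by
    ext k
    simp only [mem_inter_iff, mem_Iic, le_max_iff]
    exact and_congr_right fun hk => by rw [h k hk]
  rw [gapLeft, gapLeft, this]

theorem gapRight_congr {K : Set ℝ} {s s' : ℝ} (h : ∀ k ∈ K, s ≤ k ↔ s' ≤ k) :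
    gapRight K s = gapRight K s' := by
  have : K ∩ Ici (min s (sSup K)) = K ∩ Ici (min s' (sSup K)) := by
    ext k
    simp only [mem_inter_iff, mem_Ici, min_le_iff]
    exact and_congr_right fun hk => by rw [h k hk]
  rw [gapRight, gapRight, this]

/-- No point of K separates s from s', so both lie in the same gap. -/
theorem gap_congr {K I : Set ℝ} {s s' : ℝ} (hI : I.OrdConnected) (hfree : ∀ r ∈ I, r ∉ K)
    (hs : s ∈ I) (hs' : s' ∈ I) : gapLeft K s = gapLeft K s' ∧ gapRight K s = gapRight K s' := by
  constructor
  · refine gapLeft_congr fun k hk => ⟨fun h => ?_, fun h => ?_⟩ <;> by_contra! h'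
    · exact hfree k (hI.out hs' hs ⟨h'.le, h⟩) hk
    · exact hfree k (hI.out hs hs' ⟨h'.le, h⟩) hk
  · refine gapRight_congr fun k hk => ⟨fun h => ?_, fun h => ?_⟩ <;> by_contra! h'
    · exact hfree k (hI.out hs hs' ⟨h, h'.le⟩) hk
    · exact hfree k (hI.out hs' hs ⟨h, h'.le⟩) hk

/-! ### Assembly of the extension -/

namespace Engel

theorem continuous_mk {f g h k : ℝ → ℝ} (hf : Continuous f) (hg : Continuous g) (hh : Continuous h)
    (hk : Continuous k) : Continuous fun s => mk (f s) (g s) (h s) (k s) := by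
  rw [funext fun s => mk_eq (f s) (g s) (h s) (k s)]
  fun_prop

theorem IsSmoothHorizontal.continuous {Γ : ℝ → Engel} {u v : ℝ → ℝ}
    (h : IsSmoothHorizontal Γ u v) : Continuous Γ :=
  continuous_iff_continuousAt.2 fun s => (h.hasDerivAt s).continuousAt

theorem IsSmoothHorizontal.hasLieDerivAt {Γ : ℝ → Engel} {u v : ℝ → ℝ}
    (h : IsSmoothHorizontal Γ u v) (s : ℝ) : HasLieDerivAt Γ (u s • X₁ + v s • X₂) s := by
  rw [HasLieDerivAt, leftInvariantField_X₁_X₂]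
  exact h.hasDerivAt s

theorem IsSmoothHorizontal.isC1H {Γ : ℝ → Engel} {u v : ℝ → ℝ} (h : IsSmoothHorizontal Γ u v) :
    IsC1H horizontalFrame Γ := by
  refine ⟨contDiff_one_iff_deriv.2 ⟨fun s => (h.hasDerivAt s).differentiableAt, ?_⟩,
    fun s => ⟨_, ?_, h.hasLieDerivAt s⟩⟩
  · rw [funext fun s => (h.hasDerivAt s).deriv]
    have h0 : Continuous fun s => coord 0 (Γ s) := (coord 0).continuous.comp h.continuous
    have hu := h.1
    have hv := h.2
    exact continuous_mk (by fun_prop) (by fun_prop) (by fun_prop) (by fun_prop)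
  · exact add_mem (Submodule.smul_mem _ _ (Submodule.subset_span ⟨0, rfl⟩))
      (Submodule.smul_mem _ _ (Submodule.subset_span ⟨1, rfl⟩))

theorem tendsto_arcData {K : Set ℝ} {γ : ℝ → Engel} {w : ℝ → ℝ × ℝ} (hw : ContinuousOn w K) {t : ℝ}
    (ht : t ∈ K) (hlim : Tendsto (scaledIncrement γ) (offDiagNhds K t) (𝓝 (expData (w t)).2.2)) :
    Tendsto (fun z : ℝ × ℝ => arcData (γ z.1) (γ z.2) (w z.1) (w z.2) (z.2 - z.1))
      (offDiagNhds K t) (𝓝 (expData (w t))) := by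
  have h1 : Tendsto (fun z : ℝ × ℝ => w z.1) (offDiagNhds K t) (𝓝 (w t)) :=
    (hw t ht).tendsto.comp (tendsto_fst_offDiagNhds K t)
  have h2 : Tendsto (fun z : ℝ × ℝ => w z.2) (offDiagNhds K t) (𝓝 (w t)) :=
    (hw t ht).tendsto.comp (tendsto_snd_offDiagNhds K t)
  exact h1.prodMk_nhds (h2.prodMk_nhds hlim)

/-- On `K`, a curve with the infinitesimal increments of the one-parameter subgroups has the
corresponding horizontal derivative. -/
theorem hasDerivWithinAt_coord_of_tendsto {K : Set ℝ} {γ : ℝ → Engel} {w : ℝ × ℝ} {t : ℝ}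
    (ht : t ∈ K) (hlim : Tendsto (scaledIncrement γ) (offDiagNhds K t) (𝓝 (expData w).2.2))
    (i : Fin 4) : HasDerivWithinAt (fun s => coord i (γ s))
      (coord i (mk w.1 w.2 (coord 0 (γ t) * w.2) (coord 0 (γ t) ^ 2 / 2 * w.2))) K t := by
  rw [hasDerivWithinAt_iff_tendsto_slope]
  have hid : Tendsto (fun s : ℝ => s) (𝓝[K \ {t}] t) (𝓝 t) :=
    tendsto_id.mono_left nhdsWithin_le_nhds
  have hmem : ∀ᶠ s in 𝓝[K \ {t}] t, s ∈ K \ {t} := self_mem_nhdsWithin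
  have hmap : Tendsto (fun s => (t, s)) (𝓝[K \ {t}] t) (offDiagNhds K t) :=
    tendsto_offDiagNhds tendsto_const_nhds hid
      (hmem.mono fun s hs => ⟨ht, hs.1, fun h => hs.2 h.symm⟩)
  have hp := hlim.comp hmap
  have hh : Tendsto (fun s => s - t) (𝓝[K \ {t}] t) (𝓝 0) := by simpa using hid.sub_const t
  let c := coord 0 (γ t)
  -- The difference quotient of γ(s) = γ(t) · (γ(t)⁻¹ γ(s)) in terms of h = s - t and the scaled
  -- increment. The coordinates of higher weight carry a factor h or h² and drop out in the limit.
  let F : ℝ × (ℝ × ℝ × ℝ × ℝ) → Engel := fun q => mk q.2.1 q.2.2.1 (q.1 * q.2.2.2.1 + c * q.2.2.1)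
    (q.1 ^ 2 * q.2.2.2.2 + c ^ 2 / 2 * q.2.2.1 + c * (q.1 * q.2.2.2.1))
  have hF : Continuous F := by
    simp only [F, mk_eq (Prod.fst (Prod.snd _))]
    fun_prop
  have key := ((coord i).continuous.comp hF).continuousAt.tendsto.comp (hh.prodMk_nhds hp)
  have hval : F (0, (expData w).2.2) = mk w.1 w.2 (c * w.2) (c ^ 2 / 2 * w.2) := by
    simp [F, expData]
  rw [Function.comp_apply, hval] at key
  refine key.congr' ?_
  filter_upwards [hmem] with s hs
  have hne : s - t ≠ 0 := sub_ne_zero.2 hs.2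
  rw [slope_def_field]
  simp only [Function.comp_apply, F, scaledIncrement, c]
  fin_cases i <;> simp [mul_def, inv_def] <;> field_simp <;> ring

/-- A curve on a compact set which has the infinitesimal increments of the one-parameter subgroups
generated by a field of horizontal directions transversal to `X₂` extends to a horizontal curve with
continuous controls. -/
theorem exists_isSmoothHorizontal_extension {K : Set ℝ} (hK : IsCompact K) (hne : K.Nonempty)
    {γ : ℝ → Engel} {w : ℝ → ℝ × ℝ} (hw : ContinuousOn w K) (hw0 : ∀ t ∈ K, (w t).1 ≠ 0)
    (hlim : ∀ t ∈ K, Tendsto (scaledIncrement γ) (offDiagNhds K t) (𝓝 (expData (w t)).2.2)) :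
    ∃ Γ u v, IsSmoothHorizontal Γ u v ∧ ∀ t ∈ K, Γ t = γ t ∧ u t = (w t).1 ∧ v t = (w t).2 := by
  have ex : ∀ α β, ∃ (Γ : ℝ → Engel) (u v : ℝ → ℝ), α ∈ K → β ∈ K → α ≤ β →
      Connects Γ u v α β (γ α) (γ β) (w α) (w β) ∧
      (α = β → ∀ s, u s = (w α).1 ∧ v s = (w α).2) ∧
      (α < β → coord 0 ((γ α)⁻¹ * γ β) ≠ 0 → ∀ s,
        u s = arcU (arcData (γ α) (γ β) (w α) (w β) (β - α)) ((s - α) / (β - α)) ∧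
        v s = arcV (arcData (γ α) (γ β) (w α) (w β) (β - α)) ((s - α) / (β - α))) := by
    intro α β
    by_cases h : α ∈ K ∧ β ∈ K ∧ α ≤ β
    · obtain ⟨Γ, u, v, H⟩ := exists_connects_arc h.2.2 (x := γ α) (y := γ β) (hw0 α h.1)
        (hw0 β h.2.1) (fun e => by rw [e]) (fun e => by rw [e])
      exact ⟨Γ, u, v, fun _ _ _ => H⟩
    · exact ⟨fun _ => 1, 0, 0, fun h1 h2 h3 => absurd ⟨h1, h2, h3⟩ h⟩
  choose P U V H using ex
  -- On K both gap ends equal s. Beyond the extreme points of K both ends are that extreme point, so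
  -- the curve continues there with constant velocity.
  let Γ : ℝ → Engel := fun s => P (gapLeft K s) (gapRight K s) s
  let u : ℝ → ℝ := fun s => U (gapLeft K s) (gapRight K s) s
  let v : ℝ → ℝ := fun s => V (gapLeft K s) (gapRight K s) s
  have hl := gapLeft_mem hK hne
  have hr := gapRight_mem hK hne
  have hlr := gapLeft_le_gapRight hK hne
  have HC := fun s => H _ _ (hl s) (hr s) (hlr s)
  have onK : ∀ t ∈ K, Γ t = γ t ∧ u t = (w t).1 ∧ v t = (w t).2 := by
    intro t ht
    have := (H t t ht ht le_rfl).1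
    simp only [Γ, u, v, gapLeft_eq_self hK hne ht, gapRight_eq_self hK hne ht]
    exact ⟨this.left_pt, this.left_fst, this.left_snd⟩
  have onGap : ∀ I : Set ℝ, I.OrdConnected → (∀ r ∈ I, r ∉ K) → ∀ s₀ ∈ I, ∀ s ∈ I,
      Γ s = P (gapLeft K s₀) (gapRight K s₀) s ∧ u s = U (gapLeft K s₀) (gapRight K s₀) s ∧
      v s = V (gapLeft K s₀) (gapRight K s₀) s := by
    intro I hI hfree s₀ h₀ s hs
    obtain ⟨h1, h2⟩ := gap_congr hI hfree hs h₀
    simp only [Γ, u, v, h1, h2]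
    exact ⟨trivial, trivial, trivial⟩
  have offK : ∀ s₀, s₀ ∉ K → ∃ Δ u' v', IsSmoothHorizontal Δ u' v' ∧ Γ =ᶠ[𝓝 s₀] Δ ∧
      u =ᶠ[𝓝 s₀] u' ∧ v =ᶠ[𝓝 s₀] v' := by
    intro s₀ h₀
    obtain ⟨ε, hε, hball⟩ := Metric.isOpen_iff.1 hK.isClosed.isOpen_compl s₀ h₀
    have hg := onGap (Metric.ball s₀ ε) (by rw [Real.ball_eq_Ioo]; exact ordConnected_Ioo)
      (fun r hr => hball hr) s₀ (Metric.mem_ball_self hε)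
    have hev : ∀ᶠ s in 𝓝 s₀, s ∈ Metric.ball s₀ ε := Metric.ball_mem_nhds s₀ hε
    exact ⟨_, _, _, (HC s₀).1.horizontal, hev.mono fun s hs => (hg s hs).1,
      hev.mono fun s hs => (hg s hs).2.1, hev.mono fun s hs => (hg s hs).2.2⟩
  have rightGap : ∀ t ∈ K, ∀ r > t, (∀ s ∈ Ioo t r, s ∉ K) → ∃ Δ u' v',
      IsSmoothHorizontal Δ u' v' ∧ ∀ s ∈ Ico t r, Γ s = Δ s ∧ u s = u' s ∧ v s = v' s := by
    intro t ht r hr hfree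
    obtain ⟨s₀, h₀⟩ := nonempty_Ioo.2 hr
    have e : gapLeft K s₀ = t := by
      refine le_antisymm ?_ (le_gapLeft hK hne ht h₀.1.le)
      by_contra! hlt
      exact hfree _ ⟨hlt, (gapLeft_le hK hne ht h₀.1.le).trans_lt h₀.2⟩ (hl s₀)
    have hC := (HC s₀).1
    refine ⟨_, _, _, hC.horizontal, fun s hs => ?_⟩
    rcases hs.1.eq_or_lt with rfl | hlt
    · have h1 := hC.left_pt
      have h2 := hC.left_fst
      have h3 := hC.left_snd
      rw [e] at h1 h2 h3 ⊢
      rw [h1, h2, h3]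
      exact onK t ht
    · exact onGap _ ordConnected_Ioo hfree s₀ h₀ s ⟨hlt, hs.2⟩
  have leftGap : ∀ t ∈ K, ∀ r < t, (∀ s ∈ Ioo r t, s ∉ K) → ∃ Δ u' v',
      IsSmoothHorizontal Δ u' v' ∧ ∀ s ∈ Ioc r t, Γ s = Δ s ∧ u s = u' s ∧ v s = v' s := by
    intro t ht r hr' hfree
    obtain ⟨s₀, h₀⟩ := nonempty_Ioo.2 hr'
    have e : gapRight K s₀ = t := by
      refine le_antisymm (gapRight_le hK hne ht h₀.2.le) ?_
      by_contra! hlt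
      exact hfree _ ⟨h₀.1.trans_le (le_gapRight hK hne ht h₀.2.le), hlt⟩ (hr s₀)
    have hC := (HC s₀).1
    refine ⟨_, _, _, hC.horizontal, fun s hs => ?_⟩
    rcases hs.2.eq_or_lt with rfl | hlt
    · have h1 := hC.right_pt
      have h2 := hC.right_fst
      have h3 := hC.right_snd
      rw [e] at h1 h2 h3 ⊢
      rw [h1, h2, h3]
      exact onK s ht
    · exact onGap _ ordConnected_Ioo hfree s₀ h₀ s ⟨hs.1, hlt⟩
  have lim : ∀ t ∈ K, ∀ l : Filter ℝ, Tendsto (gapLeft K) l (𝓝 t) → Tendsto (gapRight K) l (𝓝 t) →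
      (∀ᶠ s in l, gapLeft K s ≤ s ∧ s ≤ gapRight K s) →
      Tendsto u l (𝓝 (u t)) ∧ Tendsto v l (𝓝 (v t)) := by
    intro t ht l h1 h2 h3
    rw [(onK t ht).2.1, (onK t ht).2.2]
    -- Where the two ends agree, the controls are the prescribed velocity at that end and converge
    -- by continuity of w. Where they differ, the pair of ends is off-diagonal and the arcs
    -- converge.
    have e : l = (l ⊓ 𝓟 {s | gapLeft K s = gapRight K s}) ⊔
        (l ⊓ 𝓟 {s | gapLeft K s = gapRight K s}ᶜ) := by
      rw [← inf_sup_left, sup_principal, union_compl_self, principal_univ, inf_top_eq]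
    have A : Tendsto u (l ⊓ 𝓟 {s | gapLeft K s = gapRight K s}) (𝓝 (w t).1) ∧
        Tendsto v (l ⊓ 𝓟 {s | gapLeft K s = gapRight K s}) (𝓝 (w t).2) := by
      have hwt : Tendsto (fun s => w (gapLeft K s)) l (𝓝 (w t)) :=
        (hw t ht).tendsto.comp (tendsto_nhdsWithin_iff.2 ⟨h1, Eventually.of_forall hl⟩)
      have hwt' := hwt.mono_left (inf_le_left (b := 𝓟 {s | gapLeft K s = gapRight K s}))
      have hm : ∀ᶠ s in l ⊓ 𝓟 {s | gapLeft K s = gapRight K s}, gapLeft K s = gapRight K s :=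
        mem_inf_of_right (mem_principal_self _)
      exact ⟨hwt'.fst_nhds.congr' (hm.mono fun s hs => ((HC s).2.1 hs s).1.symm),
        hwt'.snd_nhds.congr' (hm.mono fun s hs => ((HC s).2.1 hs s).2.symm)⟩
    have B : Tendsto u (l ⊓ 𝓟 {s | gapLeft K s = gapRight K s}ᶜ) (𝓝 (w t).1) ∧
        Tendsto v (l ⊓ 𝓟 {s | gapLeft K s = gapRight K s}ᶜ) (𝓝 (w t).2) := by
      set l' := l ⊓ 𝓟 {s | gapLeft K s = gapRight K s}ᶜ
      have hm : ∀ᶠ s in l', gapLeft K s ≠ gapRight K s := mem_inf_of_right (mem_principal_self _)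
      have hll : l' ≤ l := inf_le_left
      have hd := (tendsto_arcData hw ht (hlim t ht)).comp (tendsto_offDiagNhds (h1.mono_left hll)
        (h2.mono_left hll) (hm.mono fun s hs => ⟨hl s, hr s, hs⟩))
      have hσ : ∀ᶠ s in l', (s - gapLeft K s) / (gapRight K s - gapLeft K s) ∈ Icc (0 : ℝ) 1 := by
        filter_upwards [hm, h3.filter_mono hll] with s hs hs'
        have : 0 < gapRight K s - gapLeft K s := sub_pos.2 ((hlr s).lt_of_ne hs)
        exact ⟨div_nonneg (sub_nonneg.2 hs'.1) this.le,
          (div_le_one this).2 (sub_le_sub_right hs'.2 _)⟩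
      -- The scaled increment of x₁ tends to (w t).1 ≠ 0; this is where transversality to X₂
      -- excludes the detours.
      have hp : ∀ᶠ s in l', coord 0 ((γ (gapLeft K s))⁻¹ * γ (gapRight K s)) ≠ 0 := by
        have := hd.snd_nhds.snd_nhds.fst_nhds.eventually_ne (hw0 t ht)
        filter_upwards [this] with s hs h0
        exact hs (by simp [arcData, h0])
      obtain ⟨hU, hV⟩ := tendsto_arc_controls (hw0 t ht) hd hσ
      have harc : ∀ᶠ s in l', u s = arcU _ _ ∧ v s = arcV _ _ :=
        (hm.and hp).mono fun s hs => (HC s).2.2 ((hlr s).lt_of_ne hs.1) hs.2 s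
      exact ⟨hU.congr' (harc.mono fun s hs => hs.1.symm),
        hV.congr' (harc.mono fun s hs => hs.2.symm)⟩
    rw [e]
    exact ⟨A.1.sup B.1, A.2.sup B.2⟩
  have rightLim : ∀ t ∈ K, Tendsto u (𝓝[>] t) (𝓝 (u t)) ∧ Tendsto v (𝓝[>] t) (𝓝 (v t)) := by
    intro t ht
    -- Either a gap starts at t, and the controls there are those of a single curve, or points of K
    -- accumulate at t from the right and squeeze both gap ends to t.
    by_cases hgap : ∃ r > t, ∀ s ∈ Ioo t r, s ∉ K
    · obtain ⟨r, hr, hfree⟩ := hgap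
      obtain ⟨Δ, u', v', hΔ, heq⟩ := rightGap t ht r hr hfree
      have hev : ∀ᶠ s in 𝓝[>] t, s ∈ Ioo t r := Ioo_mem_nhdsGT hr
      have h0 := heq t ⟨le_rfl, hr⟩
      rw [h0.2.1, h0.2.2]
      exact ⟨(hΔ.1.continuousAt.tendsto.mono_left nhdsWithin_le_nhds).congr'
          (hev.mono fun s hs => (heq s ⟨hs.1.le, hs.2⟩).2.1.symm),
        (hΔ.2.continuousAt.tendsto.mono_left nhdsWithin_le_nhds).congr'
          (hev.mono fun s hs => (heq s ⟨hs.1.le, hs.2⟩).2.2.symm)⟩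
    · push Not at hgap
      have hL : ∀ᶠ s in 𝓝[>] t, t ≤ gapLeft K s ∧ gapLeft K s ≤ s := by
        filter_upwards [self_mem_nhdsWithin] with s hs
        rw [mem_Ioi] at hs
        exact ⟨le_gapLeft hK hne ht hs.le, gapLeft_le hK hne ht hs.le⟩
      have hR : ∀ a > t, ∀ᶠ s in 𝓝[>] t, s ≤ gapRight K s ∧ gapRight K s < a := by
        intro a ha
        obtain ⟨k, hk, hkK⟩ := hgap a ha
        filter_upwards [Ioo_mem_nhdsGT hk.1] with s hs
        exact ⟨le_gapRight hK hne hkK hs.2.le, (gapRight_le hK hne hkK hs.2.le).trans_lt hk.2⟩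
      have hR' := hR (t + 1) (by linarith)
      refine lim t ht _ ?_ ?_ (hL.and hR' |>.mono fun s hs => ⟨hs.1.2, hs.2.1⟩)
      · exact tendsto_of_tendsto_of_tendsto_of_le_of_le' tendsto_const_nhds
          (tendsto_id.mono_left nhdsWithin_le_nhds) (hL.mono fun s hs => hs.1)
          (hL.mono fun s hs => hs.2)
      · exact tendsto_order.2 ⟨fun a ha => hL.mono fun s hs => ha.trans_le (hs.1.trans (hlr s)),
          fun a ha => (hR a ha).mono fun s hs => hs.2⟩
  have leftLim : ∀ t ∈ K, Tendsto u (𝓝[<] t) (𝓝 (u t)) ∧ Tendsto v (𝓝[<] t) (𝓝 (v t)) := by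
    intro t ht
    by_cases hgap : ∃ r < t, ∀ s ∈ Ioo r t, s ∉ K
    · obtain ⟨r, hr, hfree⟩ := hgap
      obtain ⟨Δ, u', v', hΔ, heq⟩ := leftGap t ht r hr hfree
      have hev : ∀ᶠ s in 𝓝[<] t, s ∈ Ioo r t := Ioo_mem_nhdsLT hr
      have h0 := heq t ⟨hr, le_rfl⟩
      rw [h0.2.1, h0.2.2]
      exact ⟨(hΔ.1.continuousAt.tendsto.mono_left nhdsWithin_le_nhds).congr'
          (hev.mono fun s hs => (heq s ⟨hs.1, hs.2.le⟩).2.1.symm),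
        (hΔ.2.continuousAt.tendsto.mono_left nhdsWithin_le_nhds).congr'
          (hev.mono fun s hs => (heq s ⟨hs.1, hs.2.le⟩).2.2.symm)⟩
    · push Not at hgap
      have hR : ∀ᶠ s in 𝓝[<] t, s ≤ gapRight K s ∧ gapRight K s ≤ t := by
        filter_upwards [self_mem_nhdsWithin] with s hs
        rw [mem_Iio] at hs
        exact ⟨le_gapRight hK hne ht hs.le, gapRight_le hK hne ht hs.le⟩
      have hL : ∀ a < t, ∀ᶠ s in 𝓝[<] t, a < gapLeft K s ∧ gapLeft K s ≤ s := by
        intro a ha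
        obtain ⟨k, hk, hkK⟩ := hgap a ha
        filter_upwards [Ioo_mem_nhdsLT hk.2] with s hs
        exact ⟨hk.1.trans_le (le_gapLeft hK hne hkK hs.1.le), gapLeft_le hK hne hkK hs.1.le⟩
      have hL' := hL (t - 1) (by linarith)
      refine lim t ht _ ?_ ?_ (hL'.and hR |>.mono fun s hs => ⟨hs.1.2, hs.2.1⟩)
      · exact tendsto_order.2 ⟨fun a ha => (hL a ha).mono fun s hs => hs.1,
          fun a ha => hR.mono fun s hs => ((hlr s).trans hs.2).trans_lt ha⟩
      · exact tendsto_of_tendsto_of_tendsto_of_le_of_le' (tendsto_id.mono_left nhdsWithin_le_nhds)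
          tendsto_const_nhds (hR.mono fun s hs => hs.1) (hR.mono fun s hs => hs.2)
  have hu : Continuous u := by
    refine continuous_iff_continuousAt.2 fun t => ?_
    by_cases ht : t ∈ K
    · exact continuousAt_iff_continuous_left'_right'.2 ⟨(leftLim t ht).1, (rightLim t ht).1⟩
    · obtain ⟨Δ, u', v', hΔ, -, he, -⟩ := offK t ht
      exact hΔ.1.continuousAt.congr he.symm
  have hv : Continuous v := by
    refine continuous_iff_continuousAt.2 fun t => ?_
    by_cases ht : t ∈ K
    · exact continuousAt_iff_continuous_left'_right'.2 ⟨(leftLim t ht).2, (rightLim t ht).2⟩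
    · obtain ⟨Δ, u', v', hΔ, -, -, he⟩ := offK t ht
      exact hΔ.2.continuousAt.congr he.symm
  let D : ℝ → Engel := fun s => mk (u s) (v s) (coord 0 (Γ s) * v s) (coord 0 (Γ s) ^ 2 / 2 * v s)
  have glue : ∀ i, Continuous (fun s => coord i (D s)) →
      ∀ t, HasDerivAt (fun s => coord i (Γ s)) (coord i (D t)) t := by
    intro i hD
    refine hasDerivAt_of_gaps hK.isClosed hD (fun t ht => ?_) (fun s hs => ?_)
      (fun t ht r hr hfree => ?_) (fun t ht r hr hfree => ?_)
    · have h := hasDerivWithinAt_coord_of_tendsto ht (hlim t ht) i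
      simp only [D]
      rw [(onK t ht).1, (onK t ht).2.1, (onK t ht).2.2]
      exact h.congr (fun s hs => by rw [(onK s hs).1]) (by rw [(onK t ht).1])
    · obtain ⟨Δ, u', v', hΔ, h1, h2, h3⟩ := offK s hs
      have h := hΔ.hasDerivAt s
      rw [← h1.eq_of_nhds, ← h2.eq_of_nhds, ← h3.eq_of_nhds] at h
      exact hasDerivAt_coord (h.congr_of_eventuallyEq h1) i
    · obtain ⟨Δ, u', v', hΔ, heq⟩ := rightGap t ht r hr hfree
      have hev : ∀ᶠ s in 𝓝[≥] t, s ∈ Ico t r := Ico_mem_nhdsGE hr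
      exact ((coord i).continuous.comp hΔ.continuous).continuousWithinAt.congr_of_eventuallyEq
        (hev.mono fun s hs => congrArg (coord i) (heq s hs).1)
        (congrArg (coord i) (heq t ⟨le_rfl, hr⟩).1)
    · obtain ⟨Δ, u', v', hΔ, heq⟩ := leftGap t ht r hr hfree
      have hev : ∀ᶠ s in 𝓝[≤] t, s ∈ Ioc r t := Ioc_mem_nhdsLE hr
      exact ((coord i).continuous.comp hΔ.continuous).continuousWithinAt.congr_of_eventuallyEq
        (hev.mono fun s hs => congrArg (coord i) (heq s hs).1)
        (congrArg (coord i) (heq t ⟨hr, le_rfl⟩).1)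
  -- The field `D` involves x₁, so its continuity is not yet known. Its first component is just u,
  -- which yields the continuity of x₁ and then that of `D`.
  have g0 := glue 0 hu
  have hc : Continuous fun s => coord 0 (Γ s) :=
    continuous_iff_continuousAt.2 fun s => (g0 s).continuousAt
  have hD : Continuous D :=
    continuous_mk (by fun_prop) (by fun_prop) (by fun_prop) (by fun_prop)
  exact ⟨Γ, u, v, ⟨hu, hv, fun s => hasDerivAt_iff_coord.2 fun i =>
    glue i ((coord i).continuous.comp hD) s⟩, onK⟩

theorem eq_smul_add_smul_of_mem_V₁ {V : LieAlg} (hV : V ∈ V₁) :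
    V = lieCoord 0 V • X₁ + lieCoord 1 V • X₂ := by
  have hr : Set.range horizontalFrame = {X₁, X₂} := by
    simp [horizontalFrame, Matrix.range_cons, Matrix.range_empty, pair_comm]
  rw [V₁, horizontalLayer, hr, Submodule.mem_span_pair] at hV
  obtain ⟨a, b, rfl⟩ := hV
  apply ext_lieCoord <;> simp [X₁, X₂]

end Engel

/-- The Engel group has the `C¹_H` Whitney extension property on `V₁ \ span {X₂}`. -/
theorem corollary4p2 :
    HasC1HWhitneyExtensionProperty Engel.horizontalFrame
      ((Engel.V₁ : Set Engel.LieAlg) \ (Submodule.span ℝ {Engel.X₂} : Set Engel.LieAlg)) := by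
  intro K γ Y hK _ hYc hY hrem
  -- For empty K there are no gap ends in K, and any horizontal curve will do.
  rcases K.eq_empty_or_nonempty with rfl | hne
  · obtain ⟨Γ, hΓ⟩ := Engel.exists_connects_self 0 1 (w := (1, 0)) one_ne_zero
    exact ⟨Γ, hΓ.horizontal.isC1H, by simp, by simp⟩
  have hdec : ∀ t ∈ K, Y t =
      Engel.lieCoord 0 (Y t) • Engel.X₁ + Engel.lieCoord 1 (Y t) • Engel.X₂ :=
    fun t ht => Engel.eq_smul_add_smul_of_mem_V₁ (hY t ht).1
  have h0 : ∀ t ∈ K, Engel.lieCoord 0 (Y t) ≠ 0 := by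
    intro t ht h
    refine (hY t ht).2 ?_
    rw [hdec t ht, h, zero_smul, zero_add]
    exact Submodule.smul_mem _ _ (Submodule.mem_span_singleton_self _)
  have hc := fun i => (Engel.lieCoord i).continuous.comp_continuousOn hYc
  obtain ⟨Γ, u, v, hΓ, hon⟩ := Engel.exists_isSmoothHorizontal_extension hK hne
    (w := fun t => (Engel.lieCoord 0 (Y t), Engel.lieCoord 1 (Y t))) ((hc 0).prodMk (hc 1)) h0
    (fun t ht => Engel.tendsto_scaledIncrement hdec (hc 0) (hc 1) hrem ht)
  refine ⟨Γ, hΓ.isC1H, fun t ht => (hon t ht).1, fun t ht => ?_⟩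
  have := hΓ.hasLieDerivAt t
  rwa [(hon t ht).2.1, (hon t ht).2.2, ← hdec t ht] at this
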